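/- Let $\Sigma$ be a compact smooth surface without boundary (for instance a closed oriented surface), and let $E=\Sigma\times\mathbb{C}$ be the trivial complex line bundle with its standard trivialization $\tau$. Let $\mathcal{A}^k(\Sigma)$ be the smooth complex-valued $k$-forms, let $\mathcal{Z}^1(\Sigma)$ and $\mathcal{B}^1(\Sigma)$ be the closed and the exact $1$-forms, and let $H^1_{dR}(\Sigma)=\mathcal{Z}^1(\Sigma)/\mathcal{B}^1(\Sigma)$. A connection on $E$ is an additive operator $D$ from sections of $E$ to $E$-valued $1$-forms with $D(fs)=f\,D(s)+df\otimes s$ for $f\in\mathcal{A}^0(\Sigma)$; extend it to $E$-valued $1$-forms by $D(\alpha\otimes s)=d\alpha\otimes s-\alpha\wedge D(s)$. It is flat if $D\circ D=0$, and $\mathcal{F}$ denotes the set of flat connections. The gauge group $\mathcal{G}$ of smooth maps $g:\Sigma\to\mathbb{C}^*$ acts on connections by $g\cdot D=g^{-1}\circ D\circ g$; in terms of the connection form $\eta$, given by $D\tau=\eta\otimes\tau$, this is $\eta\mapsto\eta+g^{-1}dg$. The de Rham moduli space $\mathcal{F}/\mathcal{G}$ is the set of classes of flat connections modulo gauge transformations.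 Integration of closed $1$-forms over smooth singular $1$-simplices determines the de Rham isomorphism $H^1_{dR}(\Sigma)\cong H^1(\Sigma,\mathbb{C})$ onto singular cohomology: the class of $\eta$ corresponds to the class $\kappa$ if and only if $\kappa$ is represented by a singular cocycle whose value on every smooth $1$-simplex $\sigma$ is $\int_\sigma\eta$. Let $$i^*:H^1(\Sigma,\mathbb{Z})\longrightarrow H^1(\Sigma,\mathbb{C})\cong H^1_{dR}(\Sigma)$$ be the homomorphism induced by the inclusion $\mathbb{Z}\hookrightarrow\mathbb{C}$ of coefficients. Then $i^*$ is injective, the connection form of every flat connection is closed, and the rule that sends a flat connection with connection form $\eta$ to the class of $\frac{1}{2\pi i}\eta$ induces a bijection $$\mathcal{F}/\mathcal{G}\;\cong\;\operatorname{coker}(i^*)=H^1_{dR}(\Sigma)/i^*H^1(\Sigma,\mathbb{Z}).$$ -/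

import Mathlib

open scoped Manifold ContDiff

noncomputable section

namespace FlatLine

/-! ### Singular cohomology in degree one -/

section Singular

variable (X : Type*) [TopologicalSpace X] (A : Type*) [AddCommGroup A]

/-- Singular `n`-simplices of `X`. -/
abbrev Simplex (n : ℕ) : Type _ := C(stdSimplex ℝ (Fin (n + 1)), X)

variable {X} in
/-- The `i`-th face of a singular `(n + 1)`-simplex (the vertex `i` is omitted). -/
def Simplex.face {n : ℕ} (i : Fin (n + 2)) (σ : Simplex X (n + 1)) : Simplex X n :=
  σ.comp ⟨stdSimplex.map i.succAbove, stdSimplex.continuous_map _⟩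

/-- Singular `n`-cochains of `X` with coefficients in `A`, that is, homomorphisms to `A` from the
free abelian group on the singular `n`-simplices. -/
abbrev Cochain (n : ℕ) : Type _ := Simplex X n → A

/-- The singular coboundary operator. -/
def coboundary (n : ℕ) : Cochain X A n →+ Cochain X A (n + 1) where
  toFun c σ := ∑ i : Fin (n + 2), (-1 : ℤ) ^ (i : ℕ) • c (σ.face i)
  map_zero' := by ext; simp
  map_add' c c' := by ext; simp [Finset.sum_add_distrib]

/-- Singular `1`-cocycles. -/
abbrev Cocycle1 : AddSubgroup (Cochain X A 1) := (coboundary X A 1).ker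

/-- The first singular cohomology group `H¹(X, A)`: cocycles modulo coboundaries. -/
abbrev H1 : Type _ := Cocycle1 X A ⧸ (coboundary X A 0).range.addSubgroupOf (Cocycle1 X A)

variable {A} {B : Type*} [AddCommGroup B]

/-- Change of coefficients on `1`-cocycles. -/
def cocycleMap (f : A →+ B) : Cocycle1 X A →+ Cocycle1 X B where
  toFun c := ⟨fun σ => f (c.1 σ), by
    have h := c.2
    rw [AddMonoidHom.mem_ker] at h ⊢
    ext σ
    have := congrArg f (congrFun h σ)
    simpa [coboundary, map_sum] using this⟩
  map_zero' := by ext; simp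
  map_add' c c' := by ext; simp

/-- The homomorphism `H¹(X, A) → H¹(X, B)` induced by a homomorphism of coefficient groups. -/
def coeffMap (f : A →+ B) : H1 X A →+ H1 X B :=
  QuotientAddGroup.map _ _ (cocycleMap X f) <| by
    rintro c ⟨b, hb⟩
    refine ⟨fun τ => f (b τ), ?_⟩
    ext σ
    have := congrArg f (congrFun hb σ)
    simpa [coboundary, cocycleMap, map_sum] using this

end Singular

/-! ### Complex differential forms of degree at most two on a smooth surface -/

section Forms

variable (M : Type*) [TopologicalSpace M] [ChartedSpace (EuclideanSpace ℝ (Fin 2)) M]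

instance : ContMDiffRing 𝓘(ℝ, ℂ) ∞ ℂ where
  contMDiff_add := contMDiff_add 𝓘(ℝ, ℂ) ∞
  contMDiff_mul := by
    rw [← modelWithCornersSelf_prod, chartedSpaceSelf_prod, contMDiff_iff_contDiff]
    exact contDiff_mul

/-- Smooth complex-valued functions. -/
abbrev A0 : Type _ := C^∞⟮𝓡 2, M; 𝓘(ℝ, ℂ), ℂ⟯

/-- Complex-valued (not necessarily smooth) fields of covectors. -/
abbrev CovectorField : Type _ := ∀ x : M, TangentSpace (𝓡 2) x →L[ℝ] ℂ

variable {M}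

/-- The expression of a field of covectors in the chart around `x`: its pullback under the inverse
of the chart. -/
def CovectorField.inChart (η : CovectorField M) (x : M) (y : EuclideanSpace ℝ (Fin 2)) :
    EuclideanSpace ℝ (Fin 2) →L[ℝ] ℂ :=
  (η ((extChartAt (𝓡 2) x).symm y)).comp
    (mfderiv 𝓘(ℝ, EuclideanSpace ℝ (Fin 2)) (𝓡 2) (extChartAt (𝓡 2) x).symm y)

lemma inChart_add (η θ : CovectorField M) (x : M) :
    (η + θ).inChart x = η.inChart x + θ.inChart x := by
  ext y v; rfl

lemma inChart_mul (f : M → ℂ) (η : CovectorField M) (x : M) :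
    CovectorField.inChart (fun z => f z • η z) x
      = fun y => f ((extChartAt (𝓡 2) x).symm y) • η.inChart x y := by
  ext y v; rfl

lemma inChart_smul (c : ℂ) (η : CovectorField M) (x : M) :
    (c • η).inChart x = fun y => c • η.inChart x y :=
  inChart_mul (fun _ => c) η x

variable (M) in
/-- The fields of covectors that are smooth in charts. -/
def smoothCovectorFields : Submodule ℂ (CovectorField M) where
  carrier := {η | ∀ x : M, ContDiffOn ℝ ∞ (η.inChart x) (extChartAt (𝓡 2) x).target}
  zero_mem' x := by
    have : (0 : CovectorField M).inChart x = fun _ => 0 := by ext y v; rfl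
    rw [this]
    exact contDiffOn_const
  add_mem' hη hθ x := by
    rw [inChart_add]
    exact (hη x).add (hθ x)
  smul_mem' c η hη x := by
    rw [inChart_smul]
    exact (hη x).const_smul c

variable (M) in
/-- Smooth complex-valued `1`-forms. -/
def A1 : Type _ := smoothCovectorFields M

instance : AddCommGroup (A1 M) := (smoothCovectorFields M).addCommGroup

instance : Module ℂ (A1 M) := (smoothCovectorFields M).module

/-- The underlying field of covectors of a smooth `1`-form. -/
def A1.field (η : A1 M) : CovectorField M := Subtype.val (p := (· ∈ smoothCovectorFields M)) η

lemma A1.smooth (η : A1 M) (x : M) :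
    ContDiffOn ℝ ∞ (η.field.inChart x) (extChartAt (𝓡 2) x).target :=
  Subtype.property (p := (· ∈ smoothCovectorFields M)) η x

/-- A smooth `1`-form from a field of covectors that is smooth in charts. -/
def A1.mk (η : CovectorField M)
    (h : ∀ x : M, ContDiffOn ℝ ∞ (η.inChart x) (extChartAt (𝓡 2) x).target) : A1 M :=
  (⟨η, h⟩ : smoothCovectorFields M)

lemma A1.ext {η θ : A1 M} (h : ∀ x v, η.field x v = θ.field x v) : η = θ :=
  Subtype.ext (funext fun x => ContinuousLinearMap.ext (h x))

lemma A1.field_add (η θ : A1 M) : (η + θ).field = η.field + θ.field := rfl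

lemma A1.field_smul (c : ℂ) (η : A1 M) : (c • η).field = c • η.field := rfl

/-- The product of a smooth function and a smooth `1`-form. -/
instance [IsManifold (𝓡 2) ∞ M] : SMul (A0 M) (A1 M) where
  smul f η := A1.mk (fun x => f x • η.field x) fun x => by
    rw [inChart_mul]
    have h := (f.contMDiff.contMDiffOn (s := Set.univ)).comp (contMDiffOn_extChartAt_symm x)
      (fun _ _ => Set.mem_univ _)
    exact (contMDiffOn_iff_contDiffOn.1 h).smul (η.smooth x)

variable [IsManifold (𝓡 2) ∞ M]

lemma one_smul_form (η : A1 M) : (1 : A0 M) • η = η :=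
  A1.ext fun _ _ => one_mul _

lemma mul_smul_form (f g : A0 M) (η : A1 M) : (f * g) • η = f • g • η :=
  A1.ext fun _ _ => mul_assoc _ _ _

lemma smul_add_form (f : A0 M) (η θ : A1 M) : f • (η + θ) = f • η + f • θ :=
  A1.ext fun _ _ => mul_add _ _ _

lemma smul_zero_form (f : A0 M) : f • (0 : A1 M) = 0 :=
  A1.ext fun _ _ => mul_zero _

lemma inChart_mfderiv (f : A0 M) (x : M) :
    Set.EqOn (CovectorField.inChart (M := M) (fun z => mfderiv (𝓡 2) 𝓘(ℝ, ℂ) f z) x)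
      (fderiv ℝ (f ∘ (extChartAt (𝓡 2) x).symm)) (extChartAt (𝓡 2) x).target := by
  intro y hy
  have h1 : MDifferentiableAt (𝓡 2) 𝓘(ℝ, ℂ) f ((extChartAt (𝓡 2) x).symm y) :=
    f.contMDiff.mdifferentiableAt (by simp)
  have h2 : MDifferentiableAt 𝓘(ℝ, EuclideanSpace ℝ (Fin 2)) (𝓡 2) (extChartAt (𝓡 2) x).symm y :=
    ((contMDiffOn_extChartAt_symm (n := ∞) x).contMDiffAt
      ((isOpen_extChartAt_target x).mem_nhds hy)).mdifferentiableAt (by simp)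
  have h3 := mfderiv_comp y h1 h2
  rw [mfderiv_eq_fderiv] at h3
  exact h3.symm

/-- The differential of a smooth function. -/
def d0 : A0 M →+ A1 M where
  toFun f := A1.mk (fun x => mfderiv (𝓡 2) 𝓘(ℝ, ℂ) f x) fun x => by
    refine ContDiffOn.congr ?_ (inChart_mfderiv f x)
    have h := (f.contMDiff.contMDiffOn (s := Set.univ)).comp (contMDiffOn_extChartAt_symm x)
      (fun _ _ => Set.mem_univ _)
    exact (contMDiffOn_iff_contDiffOn.1 h).fderiv_of_isOpen (isOpen_extChartAt_target x) le_rfl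
  map_zero' := by
    refine A1.ext fun x v => ?_
    have : mfderiv (𝓡 2) 𝓘(ℝ, ℂ) (fun _ : M => (0 : ℂ)) x = 0 := mfderiv_const
    exact DFunLike.congr_fun this v
  map_add' f g := by
    refine A1.ext fun x v => ?_
    have hf : MDifferentiableAt (𝓡 2) 𝓘(ℝ, ℂ) f x := f.contMDiff.mdifferentiableAt (by simp)
    have hg : MDifferentiableAt (𝓡 2) 𝓘(ℝ, ℂ) g x := g.contMDiff.mdifferentiableAt (by simp)
    exact DFunLike.congr_fun (mfderiv_add hf hg) v

lemma d0_mul (f g : A0 M) : d0 (f * g) = f • d0 g + g • d0 f := by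
  refine A1.ext fun x v => ?_
  have hf : MDifferentiableAt (𝓡 2) 𝓘(ℝ, ℂ) f x := f.contMDiff.mdifferentiableAt (by simp)
  have hg : MDifferentiableAt (𝓡 2) 𝓘(ℝ, ℂ) g x := g.contMDiff.mdifferentiableAt (by simp)
  exact DFunLike.congr_fun (hf.hasMFDerivAt.mul hg.hasMFDerivAt).mfderiv v

/-- A constant function. -/
def A0.const (c : ℂ) : A0 M := ⟨fun _ => c, contMDiff_const⟩

lemma d0_const (c : ℂ) : d0 (A0.const c : A0 M) = 0 := by
  refine A1.ext fun x v => ?_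
  have : mfderiv (𝓡 2) 𝓘(ℝ, ℂ) (fun _ : M => c) x = 0 := mfderiv_const
  exact DFunLike.congr_fun this v

lemma d0_const_mul (c : ℂ) (f : A0 M) : d0 (A0.const c * f) = c • d0 f := by
  rw [d0_mul, d0_const, smul_zero_form, add_zero]
  rfl

/-- The exterior derivative of a `1`-form on the plane. -/
def planeDeriv (w : EuclideanSpace ℝ (Fin 2) → EuclideanSpace ℝ (Fin 2) →L[ℝ] ℂ) :
    EuclideanSpace ℝ (Fin 2) → EuclideanSpace ℝ (Fin 2) [⋀^Fin 2]→L[ℝ] ℂ :=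
  extDeriv fun y => ContinuousAlternatingMap.ofSubsingleton ℝ (EuclideanSpace ℝ (Fin 2)) ℂ
    (0 : Fin 1) (w y)

/-- The differential at `x` of the chart around `x`. -/
def chartDeriv (x : M) : TangentSpace (𝓡 2) x →L[ℝ] EuclideanSpace ℝ (Fin 2) :=
  mfderiv (𝓡 2) 𝓘(ℝ, EuclideanSpace ℝ (Fin 2)) (extChartAt (𝓡 2) x) x

/-- The exterior derivative of a `1`-form, computed at each point in the chart around it. -/
def d1 (η : A1 M) (x : M) : TangentSpace (𝓡 2) x [⋀^Fin 2]→L[ℝ] ℂ :=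
  (planeDeriv (η.field.inChart x) (extChartAt (𝓡 2) x x)).compContinuousLinearMap (chartDeriv x)

/-- The wedge product of two covectors, `(α ∧ β)(v, w) = α(v) β(w) - α(w) β(v)`. -/
def wedge {V : Type*} [AddCommGroup V] [Module ℝ V] [TopologicalSpace V] (α β : V →L[ℝ] ℂ) :
    V [⋀^Fin 2]→L[ℝ] ℂ where
  toFun v := α (v 0) * β (v 1) - α (v 1) * β (v 0)
  map_update_add' m i x y := by
    fin_cases i <;> simp [Function.update] <;> ring
  map_update_smul' m i c x := by
    fin_cases i <;> simp [Function.update] <;> ring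
  map_eq_zero_of_eq' v i j h hij := by
    fin_cases i <;> fin_cases j <;> simp_all
  cont := by fun_prop

lemma differentiableAt_inChart (η : A1 M) (x : M) :
    DifferentiableAt ℝ (η.field.inChart x) (extChartAt (𝓡 2) x x) :=
  ((η.smooth x).contDiffAt ((isOpen_extChartAt_target x).mem_nhds
    (mem_extChartAt_target x))).differentiableAt (by simp)

lemma planeDeriv_apply {w : EuclideanSpace ℝ (Fin 2) → EuclideanSpace ℝ (Fin 2) →L[ℝ] ℂ}
    {y : EuclideanSpace ℝ (Fin 2)} (h : DifferentiableAt ℝ w y)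
    (v : Fin 2 → EuclideanSpace ℝ (Fin 2)) :
    planeDeriv w y v = fderiv ℝ w y (v 0) (v 1) - fderiv ℝ w y (v 1) (v 0) := by
  let L := (ContinuousAlternatingMap.ofSubsingletonLIE (𝕜 := ℝ) (E := EuclideanSpace ℝ (Fin 2))
    (F := ℂ) (0 : Fin 1)).toContinuousLinearEquiv
  have h1 : HasFDerivAt (fun y => ContinuousAlternatingMap.ofSubsingleton ℝ
      (EuclideanSpace ℝ (Fin 2)) ℂ (0 : Fin 1) (w y)) (L.toContinuousLinearMap ∘L fderiv ℝ w y) y :=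
    L.toContinuousLinearMap.hasFDerivAt.comp y h.hasFDerivAt
  unfold planeDeriv extDeriv
  rw [h1.fderiv]
  simp [ContinuousAlternatingMap.alternatizeUncurryFin_apply, Fin.sum_univ_two, L,
    Fin.removeNth, sub_eq_add_neg]

lemma d1_apply (η : A1 M) (x : M) (v : Fin 2 → TangentSpace (𝓡 2) x) :
    d1 η x v = planeDeriv (η.field.inChart x) (extChartAt (𝓡 2) x x)
      (fun i => chartDeriv x (v i)) := rfl

lemma d1_add (η θ : A1 M) (x : M) : d1 (η + θ) x = d1 η x + d1 θ x := by
  ext v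
  have h1 := differentiableAt_inChart η x
  have h2 := differentiableAt_inChart θ x
  rw [ContinuousAlternatingMap.add_apply, d1_apply, d1_apply, d1_apply, A1.field_add,
    inChart_add, planeDeriv_apply h1, planeDeriv_apply h2, planeDeriv_apply (h1.add h2),
    fderiv_add h1 h2]
  simp only [add_apply]
  ring

lemma d1_smul (c : ℂ) (η : A1 M) (x : M) : d1 (c • η) x = c • d1 η x := by
  ext v
  have h1 := differentiableAt_inChart η x
  rw [ContinuousAlternatingMap.smul_apply, d1_apply, d1_apply, A1.field_smul,
    inChart_smul, planeDeriv_apply h1, show (fun y => c • η.field.inChart x y)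
      = c • η.field.inChart x from rfl, planeDeriv_apply (h1.const_smul c),
    fderiv_const_smul h1]
  simp only [smul_apply, smul_eq_mul]
  ring

variable (M) in
/-- Closed complex-valued `1`-forms. -/
def Z1 : Submodule ℂ (A1 M) where
  carrier := {η | ∀ x, d1 η x = 0}
  zero_mem' x := by
    ext v
    have h := congrArg (fun T => T v) (d1_smul 0 (0 : A1 M) x)
    rw [zero_smul] at h
    exact h.trans (zero_mul _)
  add_mem' hη hθ x := by rw [d1_add, hη x, hθ x, add_zero]
  smul_mem' c η hη x := by
    ext v
    rw [d1_smul, hη x]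
    exact mul_zero c

variable (M) in
/-- Exact complex-valued `1`-forms. -/
def B1 : Submodule ℂ (A1 M) where
  carrier := {η | ∃ f : A0 M, d0 f = η}
  zero_mem' := ⟨0, map_zero _⟩
  add_mem' := by
    rintro _ _ ⟨f, rfl⟩ ⟨g, rfl⟩
    exact ⟨f + g, map_add _ _ _⟩
  smul_mem' := by
    rintro c _ ⟨f, rfl⟩
    exact ⟨_, d0_const_mul c f⟩

variable (M) in
/-- The first complex de Rham cohomology `H¹(M) = Z¹(M) / B¹(M)`. -/
abbrev H1dR : Type _ := Z1 M ⧸ (B1 M).comap (Z1 M).subtype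

end Forms

/-! ### Integration of `1`-forms and the comparison of cohomology classes -/

section Periods

variable {M : Type*} [TopologicalSpace M] [ChartedSpace (EuclideanSpace ℝ (Fin 2)) M]

/-- A singular `1`-simplex as a path on `[0, 1]`, from its vertex `0` to its vertex `1` (extended
by constants to the real line). -/
def Simplex.path (σ : Simplex M 1) (t : ℝ) : M :=
  σ (stdSimplexHomeomorphUnitInterval.symm (Set.projIcc 0 1 zero_le_one t))

/-- A singular `1`-simplex is smooth if it is a smooth path. -/
def Simplex.IsSmooth (σ : Simplex M 1) : Prop :=
  ContMDiffOn 𝓘(ℝ, ℝ) (𝓡 2) ∞ σ.path (Set.Icc 0 1)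

/-- The integral of a `1`-form along a (smooth) singular `1`-simplex. -/
def integral (η : A1 M) (σ : Simplex M 1) : ℂ :=
  ∫ t in (0 : ℝ)..1, η.field (σ.path t)
    (mfderivWithin 𝓘(ℝ, ℝ) (𝓡 2) σ.path (Set.Icc 0 1) t (1 : ℝ))

/-- A closed `1`-form `η` represents the singular class `κ` if `κ` is the class of a singular
cocycle whose value on every smooth `1`-simplex is the integral of `η`. -/
def Represents [IsManifold (𝓡 2) ∞ M] (η : Z1 M) (κ : H1 M ℂ) : Prop :=
  ∃ c : Cocycle1 M ℂ, (QuotientAddGroup.mk c : H1 M ℂ) = κ ∧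
    ∀ σ : Simplex M 1, σ.IsSmooth → c.1 σ = integral η.1 σ

end Periods

/-! ### Connections on the trivial line bundle and gauge transformations -/

section Connections

variable (M : Type*) [TopologicalSpace M] [ChartedSpace (EuclideanSpace ℝ (Fin 2)) M]
  [IsManifold (𝓡 2) ∞ M]

/-- A connection on the trivial complex line bundle with its fixed trivialization, so that
`E`-valued forms are complex-valued forms. (By the Leibniz rule it is complex linear.) -/
@[ext]
structure Connection where
  /-- The covariant differential of a section. -/
  toHom : A0 M →+ A1 M
  leibniz (f s : A0 M) : toHom (f * s) = f • toHom s + s • d0 f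

/-- The gauge group of smooth maps to the nonzero complex numbers. -/
abbrev Gauge : Type _ := C^∞⟮𝓡 2, M; 𝓘(ℝ, ℂ), ℂˣ⟯

variable {M}

/-- A gauge transformation as a complex-valued function. -/
def Gauge.toA0 (g : Gauge M) : A0 M :=
  ⟨fun x => (g x : ℂ), Units.contMDiff_val.comp g.contMDiff⟩

lemma Gauge.toA0_one : Gauge.toA0 (1 : Gauge M) = 1 := rfl

lemma Gauge.toA0_mul (g h : Gauge M) : (g * h).toA0 = g.toA0 * h.toA0 := rfl

lemma Gauge.toA0_inv_mul (g : Gauge M) : (g⁻¹).toA0 * g.toA0 = 1 := by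
  rw [← Gauge.toA0_mul, inv_mul_cancel, Gauge.toA0_one]

/-- The extension of the covariant differential to `E`-valued `1`-forms,
`D (α τ) = dα τ - α ∧ D τ`, where `τ = 1` is the trivialization. -/
def Connection.extend (D : Connection M) (α : A1 M) (x : M) :
    TangentSpace (𝓡 2) x [⋀^Fin 2]→L[ℝ] ℂ :=
  d1 α x - wedge (α.field x) ((D.toHom 1).field x)

/-- A connection is flat if its curvature, given by `s ↦ D (D s)`, vanishes. -/
def Connection.IsFlat (D : Connection M) : Prop :=
  ∀ (s : A0 M) (x : M), D.extend (D.toHom s) x = 0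

/-- The action of gauge transformations on connections, `(g • D) s = g⁻¹ D (g s)`. In terms of
the connection form it is `η ↦ η + g⁻¹ dg`. -/
instance gaugeAction : MulAction (Gauge M) (Connection M) where
  smul g D :=
    { toHom :=
        { toFun := fun s => Gauge.toA0 g⁻¹ • D.toHom (g.toA0 * s)
          map_zero' := by rw [mul_zero, map_zero, smul_zero_form]
          map_add' := fun s t => by rw [mul_add, map_add, smul_add_form] }
      leibniz := fun f s => by
        change Gauge.toA0 g⁻¹ • D.toHom (g.toA0 * (f * s))
          = f • Gauge.toA0 g⁻¹ • D.toHom (g.toA0 * s) + s • d0 f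
        rw [mul_left_comm, D.leibniz, smul_add_form, ← mul_smul_form, ← mul_smul_form,
          ← mul_smul_form, mul_comm f, ← mul_assoc, Gauge.toA0_inv_mul, one_mul] }
  one_smul D := by
    refine Connection.ext (AddMonoidHom.ext fun s => ?_)
    change Gauge.toA0 (1⁻¹ : Gauge M) • D.toHom (Gauge.toA0 (1 : Gauge M) * s) = D.toHom s
    rw [inv_one, Gauge.toA0_one, one_mul, one_smul_form]
  mul_smul g h D := by
    refine Connection.ext (AddMonoidHom.ext fun s => ?_)
    change Gauge.toA0 (g * h)⁻¹ • D.toHom ((g * h).toA0 * s)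
      = Gauge.toA0 g⁻¹ • Gauge.toA0 h⁻¹ • D.toHom (h.toA0 * (g.toA0 * s))
    rw [mul_inv, Gauge.toA0_mul, Gauge.toA0_mul, mul_smul_form, mul_left_comm, mul_assoc]

variable (M) in
/-- Flat connections. -/
abbrev FlatConnection : Type _ := {D : Connection M // D.IsFlat}

variable (M) in
/-- The de Rham moduli space: flat connections modulo gauge transformations. -/
abbrev Moduli : Type _ :=
  Quotient ((MulAction.orbitRel (Gauge M) (Connection M)).comap
    (Subtype.val : FlatConnection M → Connection M))

end Connections

end FlatLine
end

/-!
A closed `1`-form has primitives locally, and any two of them differ by a constant. Pulled back to a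
simplex, which is simply connected, they glue to a single function, and its increment between the
vertices is the period of the form along the simplex. The periods form a singular cocycle: it is the
only one with the same local potentials as the form, and on smooth simplices it is given by
integration. Conversely, every singular cocycle has local potentials, because balls are
contractible, and a partition of unity corrects them to smooth functions that are still local
primitives of one closed form. This is the de Rham isomorphism.

A connection is determined by its connection form `η`, and its curvature is `dη`. Forms `η` and `η'`
are gauge equivalent if and only if `θ = (2πi)⁻¹(η - η')` satisfies `dg = 2πi g θ` for some
`g : M → ℂˣ`. Locally the solutions `g` are the constant multiples of `exp (2πi F)` with `F` a
primitive of `θ`, so a global one exists if and only if the image of the class of `θ` in `H¹(M, ℂˣ)`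
under `z ↦ exp (2πiz)` vanishes. By exactness of `0 → ℤ → ℂ → ℂˣ → 0` this means that the class of
`θ` is integral.
-/

noncomputable section

namespace FlatLine

open Filter Topology

/-! ### Functions with the same increments -/

section SameIncrements

variable {X Y A : Type*} [TopologicalSpace X] [TopologicalSpace Y] [AddCommGroup A]

/-- Two functions have the same increments at `x` if they differ by a constant near `x`. In this
way "being a primitive of the same form, or of the same cocycle" is expressed for functions that
need not be continuous. -/
def SameIncrementsAt (F G : X → A) (x : X) : Prop :=
  ∀ᶠ y in 𝓝 x, F y - F x = G y - G x

variable {F G H : X → A} {x : X}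

lemma SameIncrementsAt.symm (h : SameIncrementsAt F G x) : SameIncrementsAt G F x :=
  h.mono fun _ => Eq.symm

lemma SameIncrementsAt.trans (h₁ : SameIncrementsAt F G x) (h₂ : SameIncrementsAt G H x) :
    SameIncrementsAt F H x := by
  filter_upwards [h₁, h₂] with y h₁ h₂ using h₁.trans h₂

lemma SameIncrementsAt.comp {g : Y → X} {y : Y} (h : SameIncrementsAt F G (g y))
    (hg : ContinuousAt g y) : SameIncrementsAt (F ∘ g) (G ∘ g) y :=
  hg.eventually h

lemma SameIncrementsAt.sub_eventuallyEq (h : SameIncrementsAt F G x) :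
    ∀ᶠ y in 𝓝 x, F y - G y = F x - G x :=
  h.mono fun _ => sub_eq_sub_iff_sub_eq_sub.2

lemma sub_eq_sub_of_sameIncrementsAt [PreconnectedSpace X] (h : ∀ x, SameIncrementsAt F G x)
    (x y : X) : F y - F x = G y - G x :=
  have hconst : IsLocallyConstant fun x => F x - G x :=
    (IsLocallyConstant.iff_eventually_eq _).2 fun x => (h x).sub_eventuallyEq
  sub_eq_sub_iff_sub_eq_sub.1 (hconst.apply_eq_of_preconnectedSpace y x)

end SameIncrements

/-! ### Singular one-cocycles -/

section Cocycles

variable {X Y : Type*} [TopologicalSpace X] [TopologicalSpace Y]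
variable {A B : Type*} [AddCommGroup A] [AddCommGroup B]

/-- The `i`-th vertex of a singular simplex. -/
def Simplex.vertex {n : ℕ} (σ : Simplex X n) (i : Fin (n + 1)) : X := σ (stdSimplex.vertex i)

lemma Simplex.vertex_face {n : ℕ} (σ : Simplex X (n + 1)) (i : Fin (n + 2)) (j : Fin (n + 1)) :
    (σ.face i).vertex j = σ.vertex (i.succAbove j) := by
  simp [Simplex.vertex, Simplex.face]

lemma Simplex.eq_const_vertex (σ : Simplex X 0) : σ = ContinuousMap.const _ (σ.vertex 0) := by
  ext t
  rw [ContinuousMap.const_apply, Simplex.vertex, Subsingleton.elim t]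

lemma coboundary_zero_apply (b : Cochain X A 0) (σ : Simplex X 1) :
    coboundary X A 0 b σ = b (σ.face 0) - b (σ.face 1) := by
  simp [coboundary, Fin.sum_univ_two, sub_eq_add_neg]

lemma coboundary_one_apply (c : Cochain X A 1) (σ : Simplex X 2) :
    coboundary X A 1 c σ = c (σ.face 0) - c (σ.face 1) + c (σ.face 2) := by
  simp [coboundary, Fin.sum_univ_three, sub_eq_add_neg]

lemma Cocycle1.face_add_face (c : Cocycle1 X A) (σ : Simplex X 2) :
    c.1 (σ.face 2) + c.1 (σ.face 0) = c.1 (σ.face 1) := by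
  have h : coboundary X A 1 c.1 σ = 0 := congrFun c.2 σ
  rw [coboundary_one_apply] at h
  rw [← sub_eq_zero, ← h]
  abel

/-- A `1`-cocycle from a function on singular `1`-simplices that is additive on triangles. -/
def Cocycle1.mk (c : Simplex X 1 → A)
    (h : ∀ σ : Simplex X 2, c (σ.face 2) + c (σ.face 0) = c (σ.face 1)) : Cocycle1 X A :=
  ⟨c, funext fun σ => by
    rw [coboundary_one_apply, ← h σ, Pi.zero_apply]
    abel⟩

/-- The pullback of a `1`-cocycle under a continuous map. -/
def Cocycle1.comap (f : C(Y, X)) (c : Cocycle1 X A) : Cocycle1 Y A :=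
  Cocycle1.mk (fun σ => c.1 (f.comp σ)) fun σ => Cocycle1.face_add_face c (f.comp σ)

/-- The coboundary of a function on points, as a `1`-cocycle. -/
def diff : (X → A) →+ Cocycle1 X A where
  toFun b := Cocycle1.mk (fun σ => b (σ.vertex 1) - b (σ.vertex 0)) fun σ => by
    rw [add_comm]
    simp only [Simplex.vertex_face]
    exact sub_add_sub_cancel _ _ _
  map_zero' := Subtype.ext (funext fun _ => sub_self _)
  map_add' b b' := Subtype.ext (funext fun _ => add_sub_add_comm _ _ _ _)

lemma diff_apply (b : X → A) (σ : Simplex X 1) :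
    (diff b).1 σ = b (σ.vertex 1) - b (σ.vertex 0) := rfl

lemma diff_eq_coboundary (b : Cochain X A 0) :
    (diff fun x => b (ContinuousMap.const _ x)).1 = coboundary X A 0 b := by
  ext σ
  rw [diff_apply, coboundary_zero_apply, (σ.face 0).eq_const_vertex, (σ.face 1).eq_const_vertex,
    Simplex.vertex_face, Simplex.vertex_face]
  rfl

lemma mk_eq_zero_iff (c : Cocycle1 X A) :
    (QuotientAddGroup.mk c : H1 X A) = 0 ↔ ∃ b : X → A, c = diff b := by
  rw [QuotientAddGroup.eq_zero_iff]
  constructor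
  · rintro ⟨b, hb⟩
    exact ⟨_, Subtype.ext (hb.symm.trans (diff_eq_coboundary b).symm)⟩
  · rintro ⟨b, rfl⟩
    refine ⟨fun τ => b (τ.vertex 0), (diff_eq_coboundary _).symm⟩

lemma coeffMap_mk (f : A →+ B) (c : Cocycle1 X A) :
    coeffMap X f (QuotientAddGroup.mk c) = QuotientAddGroup.mk (cocycleMap X f c) := rfl

lemma exists_cocycleMap_eq {f : A →+ B} (hf : Function.Injective f) {e : Cocycle1 X B}
    (h : ∀ σ : Simplex X 1, e.1 σ ∈ f.range) : ∃ c : Cocycle1 X A, cocycleMap X f c = e := by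
  choose c hc using h
  refine ⟨Cocycle1.mk c fun σ => hf ?_, Subtype.ext (funext hc)⟩
  rw [map_add, hc, hc, hc, Cocycle1.face_add_face]

lemma coeffMap_exact {C : Type*} [AddCommGroup C] {f : A →+ B} {g : B →+ C}
    (hf : Function.Injective f) (hfg : Function.Exact f g) (hg : Function.Surjective g) :
    Function.Exact (coeffMap X f) (coeffMap X g) := fun κ => by
  obtain ⟨e, rfl⟩ := QuotientAddGroup.mk_surjective κ
  constructor
  · intro hκ
    obtain ⟨b, hb⟩ := (mk_eq_zero_iff _).1 hκ
    choose r hr using hg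
    have hlift : ∀ σ, g ((e - diff (r ∘ b)).1 σ) = 0 := fun σ => by
      have hσ : g (e.1 σ) = b (σ.vertex 1) - b (σ.vertex 0) :=
        congrFun (congrArg Subtype.val hb) σ
      change g (e.1 σ - (r (b (σ.vertex 1)) - r (b (σ.vertex 0)))) = 0
      rw [map_sub, map_sub, hr, hr, hσ, sub_self]
    obtain ⟨c, hc⟩ := exists_cocycleMap_eq hf fun σ => (hfg _).1 (hlift σ)
    have hdiff : (QuotientAddGroup.mk (diff (r ∘ b)) : H1 X B) = 0 := (mk_eq_zero_iff _).2 ⟨_, rfl⟩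
    exact ⟨QuotientAddGroup.mk c, by
      rw [coeffMap_mk, hc, QuotientAddGroup.mk_sub, hdiff, sub_zero]⟩
  · rintro ⟨κ, hκ⟩
    obtain ⟨c, rfl⟩ := QuotientAddGroup.mk_surjective κ
    have hzero : cocycleMap X g (cocycleMap X f c) = 0 :=
      Subtype.ext (funext fun σ => hfg.apply_apply_eq_zero (c.1 σ))
    rw [← hκ, coeffMap_mk, coeffMap_mk, hzero, QuotientAddGroup.mk_zero]

/-- On an injection of coefficients, a potential with values in `B` of an `A`-valued cocycle
becomes `A`-valued after subtracting representatives of its classes modulo `A`. -/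
lemma coeffMap_injective {f : A →+ B} (hf : Function.Injective f) :
    Function.Injective (coeffMap X f) := by
  refine (injective_iff_map_eq_zero _).2 fun κ hκ => ?_
  obtain ⟨c, rfl⟩ := QuotientAddGroup.mk_surjective κ
  obtain ⟨b, hb⟩ := (mk_eq_zero_iff _).1 hκ
  have hcb : ∀ σ : Simplex X 1, f (c.1 σ) = b (σ.vertex 1) - b (σ.vertex 0) :=
    fun σ => congrFun (congrArg Subtype.val hb) σ
  let r : B → B := fun z => (QuotientAddGroup.mk z : B ⧸ f.range).out
  have hr : ∀ z, ∃ a, f a = z - r z := fun z => by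
    have h := QuotientAddGroup.eq.1 (QuotientAddGroup.out_eq' (QuotientAddGroup.mk z : B ⧸ f.range))
    rwa [neg_add_eq_sub] at h
  choose a ha using hr
  refine (mk_eq_zero_iff c).2 ⟨a ∘ b, Subtype.ext (funext fun σ => hf ?_)⟩
  have hσ : r (b (σ.vertex 1)) = r (b (σ.vertex 0)) :=
    congrArg Quotient.out (QuotientAddGroup.eq.2 ⟨-c.1 σ, by rw [map_neg, hcb]; abel⟩)
  rw [diff_apply, map_sub, Function.comp_apply, Function.comp_apply, ha, ha, hσ, hcb,
    sub_sub_sub_cancel_right]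

/-- The function `F` is a potential of the cocycle `c` on `U`: the value of `c` on a simplex in
`U` is the increment of `F` between its vertices. -/
def IsPotentialOn (c : Cocycle1 X A) (F : X → A) (U : Set X) : Prop :=
  ∀ σ : Simplex X 1, Set.range σ ⊆ U → c.1 σ = F (σ.vertex 1) - F (σ.vertex 0)

lemma isPotentialOn_diff (F : X → A) (U : Set X) : IsPotentialOn (diff F) F U :=
  fun _ _ => rfl

lemma IsPotentialOn.mono {c : Cocycle1 X A} {F : X → A} {U V : Set X} (h : IsPotentialOn c F V)
    (hUV : U ⊆ V) : IsPotentialOn c F U :=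
  fun σ hσ => h σ (hσ.trans hUV)

lemma IsPotentialOn.add {c e : Cocycle1 X A} {F G : X → A} {U : Set X} (hc : IsPotentialOn c F U)
    (he : IsPotentialOn e G U) : IsPotentialOn (c + e) (F + G) U := fun σ hσ =>
  (congrArg₂ (· + ·) (hc σ hσ) (he σ hσ)).trans (sub_add_sub_comm _ _ _ _)

lemma IsPotentialOn.sub {c e : Cocycle1 X A} {F G : X → A} {U : Set X} (hc : IsPotentialOn c F U)
    (he : IsPotentialOn e G U) : IsPotentialOn (c - e) (F - G) U := fun σ hσ =>
  (congrArg₂ (· - ·) (hc σ hσ) (he σ hσ)).trans (sub_sub_sub_comm _ _ _ _)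

lemma IsPotentialOn.comap {c : Cocycle1 X A} {F : X → A} {U : Set X} (h : IsPotentialOn c F U)
    (f : C(Y, X)) : IsPotentialOn (Cocycle1.comap f c) (F ∘ f) (f ⁻¹' U) := fun σ hσ =>
  h (f.comp σ) <| by
    rintro _ ⟨t, rfl⟩
    exact hσ ⟨t, rfl⟩

/-- A path, reparametrized as a singular `1`-simplex. -/
def Simplex.ofPath {x y : X} (γ : Path x y) : Simplex X 1 :=
  γ.toContinuousMap.comp (stdSimplexHomeomorphUnitInterval : C(_, _))

lemma Simplex.ofPath_vertex_zero {x y : X} (γ : Path x y) : (Simplex.ofPath γ).vertex 0 = x :=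
  γ.source

lemma Simplex.ofPath_vertex_one {x y : X} (γ : Path x y) : (Simplex.ofPath γ).vertex 1 = y :=
  γ.target

lemma IsPotentialOn.sameIncrementsAt [LocallyPathConnectedSpace X] {c : Cocycle1 X A}
    {F G : X → A} {U : Set X} {x : X} (hF : IsPotentialOn c F U) (hG : IsPotentialOn c G U)
    (hU : U ∈ 𝓝 x) : SameIncrementsAt F G x := by
  obtain ⟨V, ⟨hV, hVconn⟩, hVU⟩ := (path_connected_basis x).mem_iff.1 hU
  filter_upwards [hV] with y hy
  obtain ⟨γ, hγ⟩ := hVconn.joinedIn x (mem_of_mem_nhds hV) y hy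
  have hγU : Set.range (Simplex.ofPath γ) ⊆ U := by
    rintro _ ⟨t, rfl⟩
    exact hVU (hγ _)
  rw [← Simplex.ofPath_vertex_zero γ]
  nth_rw 1 3 [← Simplex.ofPath_vertex_one γ]
  rw [← hF _ hγU, ← hG _ hγU]

end Cocycles

/-! ### Cocycles on convex sets -/

section Convex

variable {X : Type*} [TopologicalSpace X] {A : Type*} [AddCommGroup A]
variable {E : Type*} [AddCommGroup E] [Module ℝ E] [TopologicalSpace E] [ContinuousAdd E]
  [ContinuousSMul ℝ E] {K : Set E}

/-- The affine singular simplex with given vertices in a convex set. -/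
def affineSimplex (hK : Convex ℝ K) {n : ℕ} (v : Fin (n + 1) → K) : Simplex K n where
  toFun t := ⟨∑ i, t i • (v i : E), hK.sum_mem (fun i _ => t.2.1 i) t.2.2 fun i _ => (v i).2⟩
  continuous_toFun := Continuous.subtype_mk (continuous_finsetSum _ fun i _ =>
    ((continuous_apply i).comp continuous_subtype_val).smul continuous_const) _

lemma affineSimplex_face (hK : Convex ℝ K) {n : ℕ} (v : Fin (n + 2) → K) (i : Fin (n + 2)) :
    (affineSimplex hK v).face i = affineSimplex hK (v ∘ i.succAbove) := by
  ext t
  change ∑ j, (stdSimplex.map i.succAbove t) j • (v j : E) = ∑ j, t j • (v (i.succAbove j) : E)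
  have h : ∀ j, (stdSimplex.map i.succAbove t) j = ∑ k with i.succAbove k = j, t k := fun j => by
    rw [stdSimplex.map_coe, FunOnFinite.linearMap_apply_apply]
  simp_rw [h, Finset.sum_smul]
  rw [← Finset.sum_fiberwise Finset.univ i.succAbove]
  refine Finset.sum_congr rfl fun j _ => Finset.sum_congr rfl fun k hk => ?_
  rw [(Finset.mem_filter.1 hk).2]

/-- The segment from `p` to `q` in a convex set. -/
def segmentSimplex (hK : Convex ℝ K) (p q : K) : Simplex K 1 := affineSimplex hK ![p, q]

lemma coe_segmentSimplex_apply (hK : Convex ℝ K) (p q : K) (t : stdSimplex ℝ (Fin 2)) :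
    (segmentSimplex hK p q t : E) = t 0 • (p : E) + t 1 • (q : E) := by
  change ∑ i, t i • ((![p, q] i : K) : E) = _
  simp [Fin.sum_univ_two]

lemma segmentSimplex_vertex_zero (hK : Convex ℝ K) (p q : K) :
    (segmentSimplex hK p q).vertex 0 = p := by
  ext
  simp [Simplex.vertex, coe_segmentSimplex_apply]

lemma segmentSimplex_vertex_one (hK : Convex ℝ K) (p q : K) :
    (segmentSimplex hK p q).vertex 1 = q := by
  ext
  simp [Simplex.vertex, coe_segmentSimplex_apply]

lemma segmentSimplex_self (hK : Convex ℝ K) (p : K) :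
    segmentSimplex hK p p = ContinuousMap.const _ p := by
  ext t
  rw [coe_segmentSimplex_apply, ← add_smul, ← Fin.sum_univ_two (t ·), stdSimplex.sum_eq_one,
    one_smul, ContinuousMap.const_apply]

lemma segmentSimplex_stdSimplex_vertex :
    segmentSimplex (convex_stdSimplex ℝ (Fin 2)) (stdSimplex.vertex 0) (stdSimplex.vertex 1)
      = ContinuousMap.id _ := by
  ext t i
  refine (congrFun (coe_segmentSimplex_apply _ _ _ _) i).trans ?_
  fin_cases i <;> simp

lemma Cocycle1.segment_add_segment (c : Cocycle1 K A) (hK : Convex ℝ K) (p q r : K) :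
    c.1 (segmentSimplex hK p q) + c.1 (segmentSimplex hK q r) = c.1 (segmentSimplex hK p r) := by
  have h := Cocycle1.face_add_face c (affineSimplex hK ![p, q, r])
  rw [affineSimplex_face, affineSimplex_face, affineSimplex_face] at h
  have h₂ : ![p, q, r] ∘ Fin.succAbove 2 = ![p, q] := by ext i; fin_cases i <;> rfl
  have h₀ : ![p, q, r] ∘ Fin.succAbove 0 = ![q, r] := by ext i; fin_cases i <;> rfl
  have h₁ : ![p, q, r] ∘ Fin.succAbove 1 = ![p, r] := by ext i; fin_cases i <;> rfl
  rwa [h₂, h₀, h₁] at h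

lemma Cocycle1.apply_segment_self (c : Cocycle1 K A) (hK : Convex ℝ K) (p : K) :
    c.1 (segmentSimplex hK p p) = 0 :=
  left_eq_add.1 (Cocycle1.segment_add_segment c hK p p p).symm

variable {E' : Type*} [AddCommGroup E'] [Module ℝ E'] [TopologicalSpace E'] [ContinuousAdd E']
  [ContinuousSMul ℝ E'] {L : Set E'}

lemma segmentSimplex_prod (hK : Convex ℝ K) (hL : Convex ℝ L) (p q : K × L) :
    (Homeomorph.Set.prod K L : C(_, _)).comp (segmentSimplex (hK.prod hL)
        ((Homeomorph.Set.prod K L).symm p) ((Homeomorph.Set.prod K L).symm q))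
      = (segmentSimplex hK p.1 q.1).prodMk (segmentSimplex hL p.2 q.2) := by
  ext t
  · exact (congrArg Prod.fst (coe_segmentSimplex_apply (hK.prod hL) _ _ t)).trans
      (coe_segmentSimplex_apply hK _ _ t).symm
  · exact (congrArg Prod.snd (coe_segmentSimplex_apply (hK.prod hL) _ _ t)).trans
      (coe_segmentSimplex_apply hL _ _ t).symm

/-- Both sides are the value of `c` on the diagonal of the rectangle. -/
lemma Cocycle1.rectangle (c : Cocycle1 (K × L) A) (hK : Convex ℝ K) (hL : Convex ℝ L)
    (p p' : K) (q q' : L) :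
    c.1 ((ContinuousMap.const _ p).prodMk (segmentSimplex hL q q'))
        + c.1 ((segmentSimplex hK p p').prodMk (ContinuousMap.const _ q'))
      = c.1 ((segmentSimplex hK p p').prodMk (ContinuousMap.const _ q))
        + c.1 ((ContinuousMap.const _ p').prodMk (segmentSimplex hL q q')) := by
  have htriangle : ∀ x y z : K × L,
      c.1 ((segmentSimplex hK x.1 y.1).prodMk (segmentSimplex hL x.2 y.2))
          + c.1 ((segmentSimplex hK y.1 z.1).prodMk (segmentSimplex hL y.2 z.2))
        = c.1 ((segmentSimplex hK x.1 z.1).prodMk (segmentSimplex hL x.2 z.2)) := fun x y z => by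
    simp only [← segmentSimplex_prod]
    exact Cocycle1.segment_add_segment
      (Cocycle1.comap (Homeomorph.Set.prod K L : C(↥(K ×ˢ L), K × L)) c) _ _ _ _
  have h := (htriangle (p, q) (p, q') (p', q')).trans (htriangle (p, q) (p', q) (p', q')).symm
  simpa only [segmentSimplex_self] using h

/-- The homotopy from a point to a path along segments. -/
def cone (hK : Convex ℝ K) (p : K) (τ : Simplex K 1) :
    C(stdSimplex ℝ (Fin 2) × stdSimplex ℝ (Fin 2), K) where
  toFun z := segmentSimplex hK p (τ z.2) z.1
  continuous_toFun := by
    refine continuous_induced_rng.2 ?_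
    simp only [Function.comp_def, coe_segmentSimplex_apply]
    have hcoord : ∀ i, Continuous fun z : stdSimplex ℝ (Fin 2) × stdSimplex ℝ (Fin 2) => z.1 i :=
      fun i => (continuous_apply i).comp (continuous_subtype_val.comp continuous_fst)
    exact ((hcoord 0).smul continuous_const).add ((hcoord 1).smul
      (continuous_subtype_val.comp (τ.continuous.comp continuous_snd)))

lemma Cocycle1.eq_diff_segment (c : Cocycle1 K A) (hK : Convex ℝ K) (p : K) :
    c = diff fun q => c.1 (segmentSimplex hK p q) := by
  refine Subtype.ext (funext fun τ => ?_)
  have h := Cocycle1.rectangle (Cocycle1.comap (cone hK p τ) c) (convex_stdSimplex ℝ (Fin 2))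
    (convex_stdSimplex ℝ (Fin 2)) (stdSimplex.vertex 0) (stdSimplex.vertex 1)
    (stdSimplex.vertex 0) (stdSimplex.vertex 1)
  rw [segmentSimplex_stdSimplex_vertex] at h
  have hleft : (cone hK p τ).comp ((ContinuousMap.const _ (stdSimplex.vertex 0)).prodMk
      (ContinuousMap.id _)) = segmentSimplex hK p p := by
    rw [segmentSimplex_self]
    ext t
    exact congrArg Subtype.val (segmentSimplex_vertex_zero hK p (τ t))
  have hright : (cone hK p τ).comp ((ContinuousMap.const _ (stdSimplex.vertex 1)).prodMk
      (ContinuousMap.id _)) = τ := by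
    ext t
    exact congrArg Subtype.val (segmentSimplex_vertex_one hK p (τ t))
  change c.1 ((cone hK p τ).comp _) + c.1 (segmentSimplex hK p (τ.vertex 1))
    = c.1 (segmentSimplex hK p (τ.vertex 0)) + c.1 ((cone hK p τ).comp _) at h
  rw [hleft, hright, Cocycle1.apply_segment_self, zero_add] at h
  rw [diff_apply, h, add_sub_cancel_left]

lemma Cocycle1.exists_eq_diff (c : Cocycle1 K A) (hK : Convex ℝ K) : ∃ φ : K → A, c = diff φ := by
  rcases isEmpty_or_nonempty K with h | ⟨⟨p⟩⟩
  · exact ⟨0, Subtype.ext (funext fun τ => isEmptyElim (τ.vertex 0))⟩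
  · exact ⟨_, Cocycle1.eq_diff_segment c hK p⟩

instance (ι : Type*) [Fintype ι] : LocallyPathConnectedSpace (stdSimplex ℝ ι) :=
  (convex_stdSimplex ℝ ι).locallyPathConnectedSpace

lemma Simplex.exists_comap_eq_diff (c : Cocycle1 X A) (σ : Simplex X 1) :
    ∃ φ, Cocycle1.comap σ c = diff φ ∧
      c.1 σ = φ (stdSimplex.vertex 1) - φ (stdSimplex.vertex 0) := by
  obtain ⟨φ, hφ⟩ := Cocycle1.exists_eq_diff (Cocycle1.comap σ c) (convex_stdSimplex ℝ (Fin 2))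
  exact ⟨φ, hφ, congrFun (congrArg Subtype.val hφ) (ContinuousMap.id _)⟩

lemma cocycle_eq_zero_of_small {c : Cocycle1 X A}
    (h : ∀ x, ∃ U ∈ 𝓝 x, ∀ σ : Simplex X 1, Set.range σ ⊆ U → c.1 σ = 0) : c = 0 := by
  refine Subtype.ext (funext fun σ => ?_)
  obtain ⟨φ, hφ, hσ⟩ := Simplex.exists_comap_eq_diff c σ
  have hconst : ∀ t, SameIncrementsAt φ 0 t := fun t => by
    obtain ⟨U, hU, hc⟩ := h (σ t)
    have hzero : IsPotentialOn c 0 U := fun τ hτ => (hc τ hτ).trans (sub_self _).symm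
    exact ((hφ ▸ isPotentialOn_diff φ _).sameIncrementsAt (hzero.comap σ)
      (σ.continuous.continuousAt hU))
  rw [hσ, sub_eq_sub_of_sameIncrementsAt hconst]
  exact sub_self 0

lemma cocycle_eq_of_sameIncrementsAt {c e : Cocycle1 X A}
    (h : ∀ x, ∃ U ∈ 𝓝 x, ∃ F G : X → A, IsPotentialOn c F U ∧ IsPotentialOn e G U ∧
      SameIncrementsAt F G x) : c = e := by
  rw [← sub_eq_zero]
  refine cocycle_eq_zero_of_small fun x => ?_
  obtain ⟨U, hU, F, G, hF, hG, hFG⟩ := h x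
  refine ⟨_, inter_mem hU hFG, fun σ hσ => ?_⟩
  have hvertex : ∀ i, F (σ.vertex i) - G (σ.vertex i) = F x - G x := fun i =>
    sub_eq_sub_iff_sub_eq_sub.1 (hσ ⟨_, rfl⟩).2
  have hσU := hσ.trans Set.inter_subset_left
  rw [hF.sub hG σ hσU, Pi.sub_apply, Pi.sub_apply, hvertex, hvertex, sub_self]

lemma isPotentialOn_extend {Y : Type*} [TopologicalSpace Y] {c : Cocycle1 X A} {U : Set X}
    {f : C(Y, X)} {ψ : C(U, Y)} (hfψ : ∀ u, f (ψ u) = u) {φ : Y → A}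
    (hφ : Cocycle1.comap f c = diff φ) :
    IsPotentialOn c (Function.extend Subtype.val (φ ∘ ψ) 0) U := fun σ hσ => by
  let τ : Simplex U 1 := ⟨fun t => ⟨σ t, hσ ⟨t, rfl⟩⟩, σ.continuous.subtype_mk _⟩
  have hτ : f.comp (ψ.comp τ) = σ := ContinuousMap.ext fun t => hfψ (τ t)
  have hvertex : ∀ i, Function.extend Subtype.val (φ ∘ ψ) 0 (σ.vertex i) = φ (ψ (τ.vertex i)) :=
    fun i => Subtype.val_injective.extend_apply _ _ (τ.vertex i)
  rw [hvertex, hvertex, ← hτ]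
  exact congrFun (congrArg Subtype.val hφ) (ψ.comp τ)

end Convex

/-! ### Gluing local primitives -/

/-- An open cover with a function on each member, such that on overlaps the functions differ by
locally constant functions: the data of local primitives of a closed form, or of local potentials
of a cocycle. -/
structure LocalPrimitives (ι X A : Type*) [TopologicalSpace X] [AddCommGroup A] where
  baseSet : ι → Set X
  isOpen_baseSet : ∀ i, IsOpen (baseSet i)
  indexAt : X → ι
  mem_baseSet_at : ∀ x, x ∈ baseSet (indexAt x)
  primitive : ι → X → A
  sameIncrementsAt : ∀ i j x, x ∈ baseSet i → x ∈ baseSet j →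
    SameIncrementsAt (primitive i) (primitive j) x

namespace LocalPrimitives

variable {ι X Y A : Type*} [TopologicalSpace X] [TopologicalSpace Y] [AddCommGroup A]

/-- The pullback of a system of local primitives under a continuous map. -/
def comap (P : LocalPrimitives ι X A) (f : C(Y, X)) : LocalPrimitives ι Y A where
  baseSet i := f ⁻¹' P.baseSet i
  isOpen_baseSet i := (P.isOpen_baseSet i).preimage f.continuous
  indexAt y := P.indexAt (f y)
  mem_baseSet_at y := P.mem_baseSet_at (f y)
  primitive i := P.primitive i ∘ f
  sameIncrementsAt i j y hi hj :=
    (P.sameIncrementsAt i j (f y) hi hj).comp f.continuous.continuousAt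

/-- A function that differs from each local primitive by a locally constant function. -/
def IsGlobalPrimitive (P : LocalPrimitives ι X A) (φ : X → A) : Prop :=
  ∀ i, ∀ x ∈ P.baseSet i, SameIncrementsAt φ (P.primitive i) x

lemma IsGlobalPrimitive.comap {P : LocalPrimitives ι X A} {φ : X → A} (h : P.IsGlobalPrimitive φ)
    (f : C(Y, X)) : (P.comap f).IsGlobalPrimitive (φ ∘ f) := fun i y hy =>
  (h i (f y) hy).comp f.continuous.continuousAt

lemma IsGlobalPrimitive.sameIncrementsAt {P : LocalPrimitives ι X A} {φ ψ : X → A}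
    (hφ : P.IsGlobalPrimitive φ) (hψ : P.IsGlobalPrimitive ψ) (x : X) : SameIncrementsAt φ ψ x :=
  (hφ _ x (P.mem_baseSet_at x)).trans (hψ _ x (P.mem_baseSet_at x)).symm

section Covering

variable [TopologicalSpace A] [DiscreteTopology A]

/-- The bundle of germs of primitives. In the trivialization over `P.baseSet i`, the germ of
`P.primitive i + a` at `x` has coordinate `a`. -/
def bundleCore (P : LocalPrimitives ι X A) : FiberBundleCore ι X A where
  baseSet := P.baseSet
  isOpen_baseSet := P.isOpen_baseSet
  indexAt := P.indexAt
  mem_baseSet_at := P.mem_baseSet_at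
  coordChange i j x a := a + (P.primitive i x - P.primitive j x)
  coordChange_self i x _ a := by rw [sub_self, add_zero]
  continuousOn_coordChange i j := by
    rintro ⟨x, a⟩ ⟨⟨hi, hj⟩, -⟩
    have hsub : ContinuousAt (fun y => P.primitive i y - P.primitive j y) x :=
      continuousAt_const.congr (EventuallyEq.symm (P.sameIncrementsAt i j x hi hj).sub_eventuallyEq)
    exact (continuousAt_snd.add
      (hsub.comp (x := (x, a)) continuousAt_fst)).continuousWithinAt
  coordChange_comp i j k x _ a := by abel

/-- The value of a germ of primitives at its base point. -/
def germValue (P : LocalPrimitives ι X A) (e : P.bundleCore.TotalSpace) : A :=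
  P.primitive (P.indexAt e.1) e.1 + (show A from e.2)

lemma germValue_eq (P : LocalPrimitives ι X A) (i : ι) (e : P.bundleCore.TotalSpace) :
    P.germValue e = P.primitive i e.1 + (P.bundleCore.localTriv i e).2 := by
  change _ = P.primitive i e.1
    + ((show A from e.2) + (P.primitive (P.indexAt e.1) e.1 - P.primitive i e.1))
  rw [add_left_comm, add_sub_cancel, add_comm]
  rfl

lemma isGlobalPrimitive_germValue_comp (P : LocalPrimitives ι X A)
    (s : C(X, P.bundleCore.TotalSpace)) (hs : ∀ x, (s x).proj = x) :
    P.IsGlobalPrimitive (P.germValue ∘ s) := by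
  intro i x hx
  have hsource : s x ∈ (P.bundleCore.localTriv i).source :=
    (P.bundleCore.localTriv i).mem_source.2 (Set.mem_of_eq_of_mem (hs x) hx)
  have hcoord : ContinuousAt (fun y => (P.bundleCore.localTriv i (s y)).2) x :=
    (((P.bundleCore.localTriv i).continuousAt hsource).comp s.continuous.continuousAt).snd
  filter_upwards [hcoord.eventually (IsOpen.mem_nhds (isOpen_discrete {_}) rfl)] with y hy
  rw [Function.comp_apply, Function.comp_apply, P.germValue_eq i, P.germValue_eq i, hs, hs,
    Set.mem_singleton_iff.1 hy, add_sub_add_right_eq_sub]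

end Covering

/-- Over a simply connected space the identity lifts to the covering space of germs. -/
lemma exists_isGlobalPrimitive [SimplyConnectedSpace X] [LocallyPathConnectedSpace X]
    (P : LocalPrimitives ι X A) : ∃ φ, P.IsGlobalPrimitive φ := by
  let _ : TopologicalSpace A := ⊥
  have : DiscreteTopology A := ⟨rfl⟩
  have hcover : IsCoveringMap (Bundle.TotalSpace.proj : P.bundleCore.TotalSpace → X) :=
    FiberBundle.isCoveringMap
  obtain ⟨x₀⟩ : Nonempty X := inferInstance
  obtain ⟨s, ⟨-, hs⟩, -⟩ := hcover.existsUnique_continuousMap_lifts (ContinuousMap.id X) x₀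
    ⟨x₀, (0 : A)⟩ rfl
  exact ⟨_, P.isGlobalPrimitive_germValue_comp s (congrFun hs)⟩

instance (ι : Type*) [Fintype ι] [Nonempty ι] : ContractibleSpace (stdSimplex ℝ ι) :=
  (convex_stdSimplex ℝ ι).contractibleSpace (Set.nonempty_coe_sort.1 inferInstance)

lemma exists_isPotentialOn (P : LocalPrimitives ι X A) :
    ∃ c : Cocycle1 X A, ∀ i, IsPotentialOn c (P.primitive i) (P.baseSet i) := by
  choose φ hφ using fun {n : ℕ} (σ : Simplex X n) => (P.comap σ).exists_isGlobalPrimitive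
  have hincr : ∀ {n : ℕ} (σ : Simplex X n) (ψ : stdSimplex ℝ (Fin (n + 1)) → A),
      (P.comap σ).IsGlobalPrimitive ψ → ∀ t u, φ σ t - φ σ u = ψ t - ψ u := fun σ ψ hψ t u =>
    sub_eq_sub_of_sameIncrementsAt ((hφ σ).sameIncrementsAt hψ) u t
  refine ⟨Cocycle1.mk (fun σ => φ σ (stdSimplex.vertex 1) - φ σ (stdSimplex.vertex 0))
    fun σ => ?_, fun i σ hσ => ?_⟩
  · have hface : ∀ i : Fin 3, (P.comap (σ.face i)).IsGlobalPrimitive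
        (φ σ ∘ stdSimplex.map i.succAbove) := fun i =>
      (hφ σ).comap ⟨stdSimplex.map i.succAbove, stdSimplex.continuous_map _⟩
    rw [hincr _ _ (hface 0), hincr _ _ (hface 1), hincr _ _ (hface 2), add_comm]
    simp only [Function.comp_apply, stdSimplex.map_vertex]
    exact sub_add_sub_cancel _ _ _
  · refine hincr σ (P.primitive i ∘ σ) (fun j t hj => ?_) _ _
    exact (P.comap σ).sameIncrementsAt i j t (hσ ⟨t, rfl⟩) hj

end LocalPrimitives

/-! ### Charts -/

section Charts

variable {E M : Type*} [NormedAddCommGroup E] [NormedSpace ℝ E] [TopologicalSpace M]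
  [ChartedSpace E M] {F : Type*} [NormedAddCommGroup F] [NormedSpace ℝ F]

lemma exists_chart_ball {x : M} {U : Set M} (hU : U ∈ 𝓝 x) :
    ∃ r > 0, Metric.ball (extChartAt 𝓘(ℝ, E) x x) r ⊆ (extChartAt 𝓘(ℝ, E) x).target ∧
      Set.MapsTo (extChartAt 𝓘(ℝ, E) x).symm (Metric.ball (extChartAt 𝓘(ℝ, E) x x) r) U := by
  have hsymm : (extChartAt 𝓘(ℝ, E) x).symm ⁻¹' U ∈ 𝓝 (extChartAt 𝓘(ℝ, E) x x) :=
    continuousAt_extChartAt_symm x (by rwa [extChartAt_to_inv])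
  obtain ⟨r, hr, h⟩ := Metric.mem_nhds_iff.1 (inter_mem (extChartAt_target_mem_nhds x) hsymm)
  exact ⟨r, hr, fun y hy => (h hy).1, fun y hy => (h hy).2⟩

lemma isOpen_chart_preimage (x : M) {V : Set E} (hV : IsOpen V) :
    IsOpen ((extChartAt 𝓘(ℝ, E) x).source ∩ extChartAt 𝓘(ℝ, E) x ⁻¹' V) :=
  (continuousOn_extChartAt x).isOpen_inter_preimage (isOpen_extChartAt_source x) hV

lemma exists_convex_chart (x : M) : ∃ K ⊆ (extChartAt 𝓘(ℝ, E) x).target, Convex ℝ K ∧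
    ∃ U : Set M, IsOpen U ∧ x ∈ U ∧ ∃ (f : C(K, M)) (ψ : C(U, K)),
      (∀ p : K, f p = (extChartAt 𝓘(ℝ, E) x).symm p) ∧ ∀ u, f (ψ u) = u := by
  obtain ⟨r, hr, hB, -⟩ := exists_chart_ball (E := E) (x := x) univ_mem
  refine ⟨_, hB, convex_ball _ _, _, isOpen_chart_preimage x Metric.isOpen_ball,
    ⟨mem_extChartAt_source x, Metric.mem_ball_self hr⟩,
    ⟨_, ((continuousOn_extChartAt_symm x).mono hB).domRestrict⟩,
    ⟨fun u => ⟨extChartAt 𝓘(ℝ, E) x u, u.2.2⟩, ?_⟩, fun _ => rfl,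
    fun u => (extChartAt 𝓘(ℝ, E) x).left_inv u.2.1⟩
  exact ((continuousOn_extChartAt x).comp_continuous continuous_subtype_val
    fun u => u.2.1).subtype_mk _

lemma exists_isPotentialOn_nhds (E : Type*) [NormedAddCommGroup E] [NormedSpace ℝ E]
    [ChartedSpace E M] {A : Type*} [AddCommGroup A] (c : Cocycle1 M A)
    (x : M) : ∃ U, IsOpen U ∧ x ∈ U ∧ ∃ φ, IsPotentialOn c φ U := by
  obtain ⟨K, -, hK, U, hU, hx, f, ψ, -, hfψ⟩ := exists_convex_chart (E := E) x
  obtain ⟨φ, hφ⟩ := Cocycle1.exists_eq_diff (Cocycle1.comap f c) hK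
  exact ⟨U, hU, hx, _, isPotentialOn_extend hfψ hφ⟩

lemma SameIncrementsAt.hasMFDerivAt {f g : M → F} {y : M} (h : SameIncrementsAt f g y)
    {D : TangentSpace 𝓘(ℝ, E) y →L[ℝ] F} (hg : HasMFDerivAt 𝓘(ℝ, E) 𝓘(ℝ, F) g y D) :
    HasMFDerivAt 𝓘(ℝ, E) 𝓘(ℝ, F) f y D := by
  have hconst := hg.add (hasMFDerivAt_const (I := 𝓘(ℝ, E)) (I' := 𝓘(ℝ, F)) (f y - g y) y)
  exact (hconst.congr_mfderiv (add_zero D)).congr_of_eventuallyEq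
    (h.sub_eventuallyEq.mono fun _ => eq_add_of_sub_eq')

variable [IsManifold 𝓘(ℝ, E) ∞ M]

lemma contMDiffAt_chart_symm {x : M} {z : E} (hz : z ∈ (extChartAt 𝓘(ℝ, E) x).target) :
    ContMDiffAt 𝓘(ℝ, E) 𝓘(ℝ, E) ∞ (extChartAt 𝓘(ℝ, E) x).symm z :=
  (contMDiffOn_extChartAt_symm x).contMDiffAt ((isOpen_extChartAt_target x).mem_nhds hz)

lemma mdifferentiableAt_chart {x y : M} (hy : y ∈ (extChartAt 𝓘(ℝ, E) x).source) :
    MDifferentiableAt 𝓘(ℝ, E) 𝓘(ℝ, E) (extChartAt 𝓘(ℝ, E) x) y :=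
  (contMDiffAt_extChartAt' (n := ∞)
    (by rwa [extChartAt_source] at hy)).mdifferentiableAt (by simp)

lemma mfderiv_chart_symm_comp {x y : M} (hy : y ∈ (extChartAt 𝓘(ℝ, E) x).source) :
    (mfderiv 𝓘(ℝ, E) 𝓘(ℝ, E) (extChartAt 𝓘(ℝ, E) x).symm (extChartAt 𝓘(ℝ, E) x y)).comp
      (mfderiv 𝓘(ℝ, E) 𝓘(ℝ, E) (extChartAt 𝓘(ℝ, E) x) y)
      = ContinuousLinearMap.id ℝ (TangentSpace 𝓘(ℝ, E) y) := by
  have h := mfderivWithin_extChartAt_symm_comp_mfderiv_extChartAt' (I := 𝓘(ℝ, E)) hy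
  rwa [ModelWithCorners.range_eq_univ, mfderivWithin_univ] at h

lemma mfderiv_chart_comp_symm {x : M} {z : E} (hz : z ∈ (extChartAt 𝓘(ℝ, E) x).target) :
    (mfderiv 𝓘(ℝ, E) 𝓘(ℝ, E) (extChartAt 𝓘(ℝ, E) x) ((extChartAt 𝓘(ℝ, E) x).symm z)).comp
      (mfderiv 𝓘(ℝ, E) 𝓘(ℝ, E) (extChartAt 𝓘(ℝ, E) x).symm z)
      = ContinuousLinearMap.id ℝ E := by
  have h := mfderiv_extChartAt_comp_mfderivWithin_extChartAt_symm (I := 𝓘(ℝ, E)) hz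
  rwa [ModelWithCorners.range_eq_univ, mfderivWithin_univ] at h

lemma eventually_eq_of_hasMFDerivAt_zero {f : M → F} {x : M}
    (h : ∀ᶠ y in 𝓝 x, HasMFDerivAt 𝓘(ℝ, E) 𝓘(ℝ, F) f y 0) : ∀ᶠ y in 𝓝 x, f y = f x := by
  obtain ⟨r, hr, hB, hBU⟩ := exists_chart_ball (E := E) h
  set φ := extChartAt 𝓘(ℝ, E) x
  have hxB : φ x ∈ Metric.ball (φ x) r := Metric.mem_ball_self hr
  have hderiv : ∀ z ∈ Metric.ball (φ x) r, HasFDerivAt (f ∘ φ.symm) (0 : E →L[ℝ] F) z :=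
    fun z hz => ((hBU hz).comp z ((contMDiffAt_chart_symm (hB hz)).mdifferentiableAt
      (by simp)).hasMFDerivAt).hasFDerivAt
  filter_upwards [(isOpen_chart_preimage x Metric.isOpen_ball).mem_nhds
    ⟨mem_extChartAt_source x, hxB⟩] with y hy
  have hconst := Metric.isOpen_ball.is_const_of_fderiv_eq_zero (convex_ball _ _).isPreconnected
    (fun z hz => (hderiv z hz).differentiableAt.differentiableWithinAt)
    (fun z hz => (hderiv z hz).fderiv) hy.2 hxB
  rwa [Function.comp_apply, Function.comp_apply, φ.left_inv hy.1,
    φ.left_inv (mem_extChartAt_source x)] at hconst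

end Charts

/-! ### Closed forms and their local primitives -/

section ClosedFormsVectorSpace

variable {E E' F : Type*} [NormedAddCommGroup E] [NormedSpace ℝ E] [NormedAddCommGroup E']
  [NormedSpace ℝ E'] [NormedAddCommGroup F] [NormedSpace ℝ F]

/-- A `1`-form on a normed space is closed at a point if its derivative is symmetric there. -/
def IsClosedFormAt (w : E → E →L[ℝ] F) (y : E) : Prop :=
  ∀ u v, fderiv ℝ w y u v = fderiv ℝ w y v u

lemma isClosedFormAt_fderiv {f : E → F} {y : E} (hf : ContDiffAt ℝ 2 f y) :
    IsClosedFormAt (fderiv ℝ f) y :=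
  hf.isSymmSndFDerivAt (by rw [minSmoothness_of_isRCLikeNormedField])

lemma IsClosedFormAt.pullback {w : E' → E' →L[ℝ] F} {T : E → E'} {y : E}
    (h : IsClosedFormAt w (T y)) (hw : DifferentiableAt ℝ w (T y)) (hT : ContDiffAt ℝ 2 T y) :
    IsClosedFormAt (fun z => (w (T z)).comp (fderiv ℝ T z)) y := by
  intro u v
  have hT1 : HasFDerivAt T (fderiv ℝ T y) y := (hT.differentiableAt (by simp)).hasFDerivAt
  have hT2 : HasFDerivAt (fderiv ℝ T) (fderiv ℝ (fderiv ℝ T) y) y :=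
    ((hT.fderiv_right (m := 1) (by norm_cast)).differentiableAt (by simp)).hasFDerivAt
  have hderiv : HasFDerivAt (fun z => (w (T z)).comp (fderiv ℝ T z)) _ y :=
    (hw.hasFDerivAt.comp y hT1).clm_comp hT2
  rw [hderiv.fderiv]
  change w (T y) (fderiv ℝ (fderiv ℝ T) y u v)
      + fderiv ℝ w (T y) (fderiv ℝ T y u) (fderiv ℝ T y v)
    = w (T y) (fderiv ℝ (fderiv ℝ T) y v u)
      + fderiv ℝ w (T y) (fderiv ℝ T y v) (fderiv ℝ T y u)
  rw [isClosedFormAt_fderiv hT u v, h]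

end ClosedFormsVectorSpace

section Primitives

local notation "ℝ²" => EuclideanSpace ℝ (Fin 2)

variable {M : Type*} [TopologicalSpace M] [ChartedSpace ℝ² M]

/-- The function `F` has differential `η` on `U`. -/
def IsPrimitiveOn (η : CovectorField M) (F : M → ℂ) (U : Set M) : Prop :=
  ∀ y ∈ U, HasMFDerivAt (𝓡 2) 𝓘(ℝ, ℂ) F y (η y)

variable [IsManifold (𝓡 2) ∞ M]

lemma inChart_comp_mfderiv_chart (η : CovectorField M) {x y : M}
    (hy : y ∈ (extChartAt (𝓡 2) x).source) :
    (η.inChart x (extChartAt (𝓡 2) x y)).comp (mfderiv (𝓡 2) 𝓘(ℝ, ℝ²) (extChartAt (𝓡 2) x) y)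
      = η y := by
  have hpoint : ∀ z, z = y → ∀ v : ℝ², η z v = η y v := by
    rintro _ rfl _
    rfl
  ext v
  exact (hpoint _ ((extChartAt (𝓡 2) x).left_inv hy) _).trans
    (congrArg (η y) (DFunLike.congr_fun (mfderiv_chart_symm_comp hy) v))

lemma inChart_eventuallyEq_transition (η : CovectorField M) {x p : M} {y : ℝ²}
    (hy : y ∈ (extChartAt (𝓡 2) x).target)
    (hp : (extChartAt (𝓡 2) x).symm y ∈ (extChartAt (𝓡 2) p).source) :
    η.inChart x =ᶠ[𝓝 y] fun z =>
      (η.inChart p ((extChartAt (𝓡 2) p ∘ (extChartAt (𝓡 2) x).symm) z)).comp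
        (fderiv ℝ (extChartAt (𝓡 2) p ∘ (extChartAt (𝓡 2) x).symm) z) := by
  filter_upwards [(isOpen_extChartAt_target x).mem_nhds hy,
    (contMDiffAt_chart_symm hy).continuousAt.eventually
      ((isOpen_extChartAt_source p).mem_nhds hp)] with z hz hzp
  have htransition : fderiv ℝ (extChartAt (𝓡 2) p ∘ (extChartAt (𝓡 2) x).symm) z
      = (mfderiv (𝓡 2) 𝓘(ℝ, ℝ²) (extChartAt (𝓡 2) p) ((extChartAt (𝓡 2) x).symm z)).comp
        (mfderiv 𝓘(ℝ, ℝ²) (𝓡 2) (extChartAt (𝓡 2) x).symm z) := by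
    rw [← mfderiv_eq_fderiv]
    exact mfderiv_comp z (mdifferentiableAt_chart hzp)
      ((contMDiffAt_chart_symm hz).mdifferentiableAt (by simp))
  rw [htransition]
  exact congrArg (ContinuousLinearMap.comp · _) (inChart_comp_mfderiv_chart η hzp).symm

lemma hasFDerivAt_comp_chart_symm {η : CovectorField M} {F : M → ℂ} {x : M} {z : ℝ²}
    (hz : z ∈ (extChartAt (𝓡 2) x).target)
    (hF : HasMFDerivAt (𝓡 2) 𝓘(ℝ, ℂ) F ((extChartAt (𝓡 2) x).symm z)
      (η ((extChartAt (𝓡 2) x).symm z))) :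
    HasFDerivAt (F ∘ (extChartAt (𝓡 2) x).symm) (η.inChart x z) z :=
  (hF.comp z
    ((contMDiffAt_chart_symm hz).mdifferentiableAt (by simp)).hasMFDerivAt).hasFDerivAt

lemma hasMFDerivAt_comp_chart {η : CovectorField M} {f : ℝ² → ℂ} {x y : M}
    (hy : y ∈ (extChartAt (𝓡 2) x).source)
    (hf : HasFDerivAt f (η.inChart x (extChartAt (𝓡 2) x y)) (extChartAt (𝓡 2) x y)) :
    HasMFDerivAt (𝓡 2) 𝓘(ℝ, ℂ) (f ∘ extChartAt (𝓡 2) x) y (η y) := by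
  rw [← inChart_comp_mfderiv_chart η hy]
  exact hf.hasMFDerivAt.comp y (mdifferentiableAt_chart hy).hasMFDerivAt

lemma IsPrimitiveOn.sameIncrementsAt {η : CovectorField M} {F G : M → ℂ} {U V : Set M} {x : M}
    (hF : IsPrimitiveOn η F U) (hG : IsPrimitiveOn η G V) (hU : U ∈ 𝓝 x) (hV : V ∈ 𝓝 x) :
    SameIncrementsAt F G x := by
  have hzero : ∀ᶠ y in 𝓝 x, HasMFDerivAt (𝓡 2) 𝓘(ℝ, ℂ) (F - G) y 0 := by
    filter_upwards [hU, hV] with y hyU hyV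
    exact ((hF y hyU).sub (hG y hyV)).congr_mfderiv (sub_self _)
  exact (eventually_eq_of_hasMFDerivAt_zero hzero).mono fun _ => sub_eq_sub_iff_sub_eq_sub.1

lemma IsPrimitiveOn.contMDiffAt {η : A1 M} {F : M → ℂ} {U : Set M} {x : M}
    (hF : IsPrimitiveOn η.field F U) (hU : U ∈ 𝓝 x) : ContMDiffAt (𝓡 2) 𝓘(ℝ, ℂ) ∞ F x := by
  obtain ⟨r, hr, hB, hBU⟩ := exists_chart_ball (E := ℝ²) hU
  have hderiv : ∀ z ∈ Metric.ball (extChartAt (𝓡 2) x x) r,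
      HasFDerivAt (F ∘ (extChartAt (𝓡 2) x).symm) (η.field.inChart x z) z :=
    fun z hz => hasFDerivAt_comp_chart_symm (hB hz) (hF _ (hBU hz))
  have hsmooth : ContDiffOn ℝ ∞ (F ∘ (extChartAt (𝓡 2) x).symm)
      (Metric.ball (extChartAt (𝓡 2) x x) r) := by
    rw [contDiffOn_infty_iff_fderiv_of_isOpen Metric.isOpen_ball]
    exact ⟨fun z hz => (hderiv z hz).differentiableAt.differentiableWithinAt,
      ((η.smooth x).mono hB).congr fun z hz => (hderiv z hz).fderiv⟩
  have hcomp := (hsmooth.contDiffAt (Metric.ball_mem_nhds _ hr)).contMDiffAt.comp x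
    (contMDiffAt_extChartAt (n := ∞))
  refine hcomp.congr_of_eventuallyEq ?_
  filter_upwards [extChartAt_source_mem_nhds (I := 𝓡 2) x] with y hy
  rw [Function.comp_apply, Function.comp_apply, (extChartAt (𝓡 2) x).left_inv hy]

lemma d1_eq_zero_iff (η : A1 M) (x : M) :
    d1 η x = 0 ↔ IsClosedFormAt (η.field.inChart x) (extChartAt (𝓡 2) x x) := by
  constructor
  · intro h u v
    have hsurj : Function.Surjective (chartDeriv x) := fun w => by
      have hcomp := mfderiv_chart_comp_symm (mem_extChartAt_target (I := 𝓡 2) x)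
      rw [extChartAt_to_inv] at hcomp
      exact ⟨_, DFunLike.congr_fun hcomp w⟩
    obtain ⟨u, rfl⟩ := hsurj u
    obtain ⟨v, rfl⟩ := hsurj v
    have happly := d1_apply η x ![u, v]
    rw [h, planeDeriv_apply (differentiableAt_inChart η x)] at happly
    exact sub_eq_zero.1 happly.symm
  · intro h
    ext v
    rw [d1_apply, planeDeriv_apply (differentiableAt_inChart η x), h, sub_self]
    rfl

lemma exists_inChart_eventuallyEq_fderiv {η : CovectorField M} {F : M → ℂ} {U : Set M}
    (hF : IsPrimitiveOn η F U) (hs : ContMDiffOn (𝓡 2) 𝓘(ℝ, ℂ) ∞ F U) {x : M} {y : ℝ²}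
    (hy : y ∈ (extChartAt (𝓡 2) x).target) (hU : U ∈ 𝓝 ((extChartAt (𝓡 2) x).symm y)) :
    ∃ f : ℝ² → ℂ, ContDiffAt ℝ ∞ f y ∧ η.inChart x =ᶠ[𝓝 y] fderiv ℝ f := by
  have hsymm := contMDiffAt_chart_symm hy
  refine ⟨F ∘ (extChartAt (𝓡 2) x).symm, ((hs.contMDiffAt hU).comp y hsymm).contDiffAt, ?_⟩
  filter_upwards [(isOpen_extChartAt_target x).mem_nhds hy,
    hsymm.continuousAt.eventually hU] with z hz hzU
  exact (hasFDerivAt_comp_chart_symm hz (hF _ hzU)).fderiv.symm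

/-- The field of covectors `η` is locally the differential of a smooth function. -/
def HasSmoothPrimitives (η : CovectorField M) : Prop :=
  ∀ x, ∃ U ∈ 𝓝 x, ∃ F, IsPrimitiveOn η F U ∧ ContMDiffOn (𝓡 2) 𝓘(ℝ, ℂ) ∞ F U

lemma HasSmoothPrimitives.contDiffOn_inChart {η : CovectorField M} (h : HasSmoothPrimitives η)
    (x : M) : ContDiffOn ℝ ∞ (η.inChart x) (extChartAt (𝓡 2) x).target := by
  intro y hy
  obtain ⟨U, hU, F, hF, hs⟩ := h ((extChartAt (𝓡 2) x).symm y)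
  obtain ⟨f, hf, hηf⟩ := exists_inChart_eventuallyEq_fderiv hF hs hy hU
  exact ((hf.fderiv_right (m := ∞) (by simp)).congr_of_eventuallyEq hηf).contDiffWithinAt

lemma HasSmoothPrimitives.d1_eq_zero {η : A1 M} (h : HasSmoothPrimitives η.field) (x : M) :
    d1 η x = 0 := by
  obtain ⟨U, hU, F, hF, hs⟩ := h x
  obtain ⟨f, hf, hηf⟩ := exists_inChart_eventuallyEq_fderiv hF hs (mem_extChartAt_target x)
    (by rwa [extChartAt_to_inv])
  rw [d1_eq_zero_iff, IsClosedFormAt, hηf.fderiv_eq]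
  exact isClosedFormAt_fderiv (contDiffAt_infty.1 hf 2)

lemma HasSmoothPrimitives.exists_closed {η : CovectorField M} (h : HasSmoothPrimitives η) :
    ∃ θ : Z1 M, (θ : A1 M).field = η :=
  have hη : HasSmoothPrimitives (A1.mk η h.contDiffOn_inChart).field := h
  ⟨⟨A1.mk η h.contDiffOn_inChart, hη.d1_eq_zero⟩, rfl⟩

lemma isPrimitiveOn_d0 (f : A0 M) (U : Set M) : IsPrimitiveOn (d0 f).field f U := fun y _ =>
  (f.contMDiff.mdifferentiableAt (x := y) (by simp)).hasMFDerivAt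

lemma d1_d0 (f : A0 M) (x : M) : d1 (d0 f) x = 0 :=
  HasSmoothPrimitives.d1_eq_zero
    (fun _ => ⟨_, univ_mem, f, isPrimitiveOn_d0 f _, f.contMDiff.contMDiffOn⟩) x

lemma isClosedFormAt_inChart (η : Z1 M) (x : M) {y : ℝ²} (hy : y ∈ (extChartAt (𝓡 2) x).target) :
    IsClosedFormAt (η.1.field.inChart x) y := by
  have hp := mem_extChartAt_source (I := 𝓡 2) ((extChartAt (𝓡 2) x).symm y)
  rw [IsClosedFormAt, (inChart_eventuallyEq_transition η.1.field hy hp).fderiv_eq]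
  refine IsClosedFormAt.pullback ((d1_eq_zero_iff η.1 _).1 (η.2 _)) (differentiableAt_inChart _ _)
    (contDiffAt_infty.1 (ContMDiffAt.contDiffAt ?_) 2)
  exact contMDiffAt_extChartAt.comp y (contMDiffAt_chart_symm hy)

lemma exists_isPrimitiveOn (η : Z1 M) (x : M) :
    ∃ U, IsOpen U ∧ x ∈ U ∧ ∃ F, IsPrimitiveOn η.1.field F U := by
  obtain ⟨r, hr, hB, -⟩ := exists_chart_ball (E := ℝ²) (x := x) univ_mem
  obtain ⟨f, hf⟩ := Convex.exists_forall_hasFDerivAt_of_fderiv_symmetric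
    (convex_ball (extChartAt (𝓡 2) x x) r) Metric.isOpen_ball
    (((η.1.smooth x).mono hB).differentiableOn (by simp))
    (fun z hz => isClosedFormAt_inChart η x (hB hz))
  exact ⟨_, isOpen_chart_preimage x Metric.isOpen_ball,
    ⟨mem_extChartAt_source x, Metric.mem_ball_self hr⟩, f ∘ extChartAt (𝓡 2) x,
    fun y hy => hasMFDerivAt_comp_chart hy.1 (hf _ hy.2)⟩

end Primitives

/-! ### Integration along smooth simplices -/

section Integration

/-- The affine parametrization of the standard `1`-simplex by `[0, 1]`, extended by constants to
the real line; a singular simplex `σ` satisfies `σ.path = σ ∘ simplexPoint`. -/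
def simplexPoint (t : ℝ) : stdSimplex ℝ (Fin 2) :=
  stdSimplexHomeomorphUnitInterval.symm (Set.projIcc 0 1 zero_le_one t)

lemma continuous_simplexPoint : Continuous simplexPoint :=
  stdSimplexHomeomorphUnitInterval.symm.continuous.comp continuous_projIcc

lemma coe_simplexPoint {t : ℝ} (ht : t ∈ Set.Icc (0 : ℝ) 1) :
    (simplexPoint t : Fin 2 → ℝ) = ![1 - t, t] := by
  rw [simplexPoint, Set.projIcc_of_mem _ ht]
  rfl

lemma simplexPoint_zero : simplexPoint 0 = stdSimplex.vertex 0 := by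
  refine Subtype.ext ((coe_simplexPoint ⟨le_rfl, zero_le_one⟩).trans (funext fun i => ?_))
  fin_cases i <;> simp

lemma simplexPoint_one : simplexPoint 1 = stdSimplex.vertex 1 := by
  refine Subtype.ext ((coe_simplexPoint ⟨zero_le_one, le_rfl⟩).trans (funext fun i => ?_))
  fin_cases i <;> simp

local notation "ℝ²" => EuclideanSpace ℝ (Fin 2)

variable {M : Type*} [TopologicalSpace M] [ChartedSpace ℝ² M]

lemma IsPrimitiveOn.hasDerivWithinAt_comp {η : CovectorField M} {F : M → ℂ} {U : Set M}
    (hF : IsPrimitiveOn η F U) {γ : ℝ → M} {s : Set ℝ} {t : ℝ} (ht : γ t ∈ U)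
    (hγ : ContMDiffWithinAt 𝓘(ℝ, ℝ) (𝓡 2) ∞ γ s t) {φ : ℝ → ℂ}
    (hφ : SameIncrementsAt φ (F ∘ γ) t) :
    HasDerivWithinAt φ (η (γ t) (mfderivWithin 𝓘(ℝ, ℝ) (𝓡 2) γ s t (1 : ℝ))) s t := by
  have hcomp := (hF _ ht).comp_hasMFDerivWithinAt t
    (hγ.mdifferentiableWithinAt (by simp)).hasMFDerivWithinAt
  have hconst := hcomp.hasFDerivWithinAt.add_const (φ t - F (γ t))
  exact (hconst.congr_of_eventuallyEq ((hφ.sub_eventuallyEq.mono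
    fun _ => eq_add_of_sub_eq').filter_mono nhdsWithin_le_nhds)
    (add_sub_cancel _ _).symm).hasDerivWithinAt

variable [IsManifold (𝓡 2) ∞ M]

lemma isSmooth_comp_segmentSimplex {x : M} {K : Set ℝ²} (hK : Convex ℝ K)
    (hKx : K ⊆ (extChartAt (𝓡 2) x).target) {f : C(K, M)}
    (hf : ∀ p : K, f p = (extChartAt (𝓡 2) x).symm p) (p q : K) :
    Simplex.IsSmooth (f.comp (segmentSimplex hK p q)) := by
  have hpath : ∀ t ∈ Set.Icc (0 : ℝ) 1, Simplex.path (f.comp (segmentSimplex hK p q)) t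
      = ((extChartAt (𝓡 2) x).symm ∘ fun t : ℝ => (1 - t) • (p : ℝ²) + t • (q : ℝ²)) t := by
    intro t ht
    change f (segmentSimplex hK p q (simplexPoint t)) = _
    have ht0 : simplexPoint t 0 = 1 - t := congrFun (coe_simplexPoint ht) 0
    have ht1 : simplexPoint t 1 = t := congrFun (coe_simplexPoint ht) 1
    rw [hf, coe_segmentSimplex_apply, ht0, ht1, Function.comp_apply]
  refine ContMDiffOn.congr ?_ hpath
  refine (contMDiffOn_extChartAt_symm x).comp (contMDiffOn_iff_contDiffOn.2 (by fun_prop))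
    fun t ht => hKx (hK p.2 q.2 (sub_nonneg.2 ht.2) ht.1 (sub_add_cancel _ _))

lemma cocycle_eq_zero_of_smooth {A : Type*} [AddCommGroup A] {c : Cocycle1 M A}
    (h : ∀ σ : Simplex M 1, σ.IsSmooth → c.1 σ = 0) : c = 0 := by
  refine cocycle_eq_zero_of_small fun x => ?_
  obtain ⟨K, hKx, hK, U, hU, hx, f, ψ, hf, hfψ⟩ := exists_convex_chart (E := ℝ²) x
  have hcomap : Cocycle1.comap f c = diff 0 := by
    rw [Cocycle1.eq_diff_segment (Cocycle1.comap f c) hK (ψ ⟨x, hx⟩)]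
    exact congrArg diff (funext fun p => h _ (isSmooth_comp_segmentSimplex hK hKx hf _ p))
  refine ⟨U, hU.mem_nhds hx, fun σ hσ => (isPotentialOn_extend hfψ hcomap σ hσ).trans ?_⟩
  rw [Pi.zero_comp, Function.extend_zero]
  exact sub_self 0

lemma IsPrimitiveOn.contDiffWithinAt_comp {η : A1 M} {F : M → ℂ} {U : Set M}
    (hF : IsPrimitiveOn η.field F U) {γ : ℝ → M} {s : Set ℝ} {t : ℝ} (hU : U ∈ 𝓝 (γ t))
    (hγ : ContMDiffWithinAt 𝓘(ℝ, ℝ) (𝓡 2) ∞ γ s t) {φ : ℝ → ℂ}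
    (hφ : SameIncrementsAt φ (F ∘ γ) t) : ContDiffWithinAt ℝ ∞ φ s t := by
  have hcomp := ((hF.contMDiffAt hU).comp_contMDiffWithinAt t hγ).contDiffWithinAt
  exact (hcomp.add (contDiffWithinAt_const (c := φ t - F (γ t)))).congr_of_eventuallyEq
    ((hφ.sub_eventuallyEq.mono fun _ => eq_add_of_sub_eq').filter_mono nhdsWithin_le_nhds)
    (add_sub_cancel _ _).symm

lemma integral_eq_sub {η : A1 M} {σ : Simplex M 1} (hσ : σ.IsSmooth) {φ : ℝ → ℂ}
    (hφ : ∀ t, ∃ U ∈ 𝓝 (σ.path t), ∃ F, IsPrimitiveOn η.field F U ∧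
      SameIncrementsAt φ (F ∘ σ.path) t) : integral η σ = φ 1 - φ 0 := by
  have hsmooth : ContDiffOn ℝ 1 φ (Set.Icc 0 1) := fun t ht => by
    obtain ⟨U, hU, F, hF, hφF⟩ := hφ t
    exact (hF.contDiffWithinAt_comp hU (hσ t ht) hφF).of_le (by simp)
  rw [← intervalIntegral.integral_derivWithin_Icc_of_contDiffOn_Icc hsmooth zero_le_one]
  refine intervalIntegral.integral_congr fun t ht => ?_
  rw [Set.uIcc_of_le zero_le_one] at ht
  obtain ⟨U, hU, F, hF, hφF⟩ := hφ t
  exact ((hF.hasDerivWithinAt_comp (mem_of_mem_nhds hU) (hσ t ht) hφF).derivWithin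
    (uniqueDiffOn_Icc_zero_one t ht)).symm

end Integration

/-! ### Periods of closed forms -/

section Periods

variable {M : Type*} [TopologicalSpace M] [ChartedSpace (EuclideanSpace ℝ (Fin 2)) M]

/-- The cocycle `c` is the cocycle of periods of `η`: it has the same local primitives. -/
def IsPeriod (η : A1 M) (c : Cocycle1 M ℂ) : Prop :=
  ∀ x, ∃ U, IsOpen U ∧ x ∈ U ∧ ∃ F, IsPrimitiveOn η.field F U ∧ IsPotentialOn c F U

lemma IsPeriod.add {η θ : A1 M} {c e : Cocycle1 M ℂ} (hη : IsPeriod η c) (hθ : IsPeriod θ e) :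
    IsPeriod (η + θ) (c + e) := fun x => by
  obtain ⟨U, hU, hxU, F, hF, hc⟩ := hη x
  obtain ⟨V, hV, hxV, G, hG, he⟩ := hθ x
  exact ⟨U ∩ V, hU.inter hV, ⟨hxU, hxV⟩, F + G, fun y hy => (hF y hy.1).add (hG y hy.2),
    (hc.mono Set.inter_subset_left).add (he.mono Set.inter_subset_right)⟩

lemma IsPeriod.isPrimitiveOn_univ {η : A1 M} {b : M → ℂ} (h : IsPeriod η (diff b)) :
    IsPrimitiveOn η.field b Set.univ := fun x _ => by
  obtain ⟨U, hU, hxU, F, hF, hc⟩ := h x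
  have := ChartedSpace.locallyPathConnectedSpace (EuclideanSpace ℝ (Fin 2)) M
  exact ((isPotentialOn_diff b U).sameIncrementsAt hc (hU.mem_nhds hxU)).hasMFDerivAt (hF x hxU)

variable [IsManifold (𝓡 2) ∞ M]

lemma isPeriod_d0 (f : A0 M) : IsPeriod (d0 f) (diff f) := fun x =>
  ⟨Set.univ, isOpen_univ, Set.mem_univ x, f, isPrimitiveOn_d0 f _, isPotentialOn_diff f _⟩

lemma exists_isPeriod (η : Z1 M) : ∃ c, IsPeriod η.1 c := by
  choose U hU hx F hF using exists_isPrimitiveOn η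
  let P : LocalPrimitives M M ℂ :=
    { baseSet := U
      isOpen_baseSet := hU
      indexAt := id
      mem_baseSet_at := hx
      primitive := F
      sameIncrementsAt := fun i j x hi hj =>
        (hF i).sameIncrementsAt (hF j) ((hU i).mem_nhds hi) ((hU j).mem_nhds hj) }
  obtain ⟨c, hc⟩ := P.exists_isPotentialOn
  exact ⟨c, fun x => ⟨U x, hU x, hx x, F x, hF x, hc x⟩⟩

lemma IsPeriod.unique {η : A1 M} {c e : Cocycle1 M ℂ} (hc : IsPeriod η c) (he : IsPeriod η e) :
    c = e := cocycle_eq_of_sameIncrementsAt fun x => by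
  obtain ⟨U, hU, hxU, F, hF, hcF⟩ := hc x
  obtain ⟨V, hV, hxV, G, hG, heG⟩ := he x
  exact ⟨U ∩ V, (hU.inter hV).mem_nhds ⟨hxU, hxV⟩, F, G, hcF.mono Set.inter_subset_left,
    heG.mono Set.inter_subset_right,
    hF.sameIncrementsAt hG (hU.mem_nhds hxU) (hV.mem_nhds hxV)⟩

lemma IsPeriod.eq_integral {η : A1 M} {c : Cocycle1 M ℂ} (hc : IsPeriod η c) {σ : Simplex M 1}
    (hσ : σ.IsSmooth) : c.1 σ = integral η σ := by
  obtain ⟨φ, hφ, hσφ⟩ := Simplex.exists_comap_eq_diff c σ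
  have hlocal : ∀ t, ∃ U ∈ 𝓝 (σ.path t), ∃ F, IsPrimitiveOn η.field F U ∧
      SameIncrementsAt (φ ∘ simplexPoint) (F ∘ σ.path) t := fun t => by
    obtain ⟨U, hU, hxU, F, hF, hcF⟩ := hc (σ.path t)
    have hincr : SameIncrementsAt φ (F ∘ σ) (simplexPoint t) :=
      (hφ ▸ isPotentialOn_diff φ _).sameIncrementsAt (hcF.comap σ)
        (σ.continuous.continuousAt (hU.mem_nhds hxU))
    exact ⟨U, hU.mem_nhds hxU, F, hF, hincr.comp continuous_simplexPoint.continuousAt⟩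
  rw [hσφ, integral_eq_sub hσ hlocal, Function.comp_apply, Function.comp_apply, simplexPoint_zero,
    simplexPoint_one]

lemma IsPeriod.represents_iff {η : Z1 M} {c : Cocycle1 M ℂ} (hc : IsPeriod η.1 c) (κ : H1 M ℂ) :
    Represents η κ ↔ (QuotientAddGroup.mk c : H1 M ℂ) = κ := by
  refine ⟨?_, fun h => ⟨c, h, fun σ hσ => hc.eq_integral hσ⟩⟩
  rintro ⟨e, rfl, he⟩
  have hzero : c - e = 0 := cocycle_eq_zero_of_smooth fun σ hσ =>
    sub_eq_zero.2 ((hc.eq_integral hσ).trans (he σ hσ).symm)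
  rw [sub_eq_zero.1 hzero]

lemma IsPeriod.exists_d0_eq {η : A1 M} {b : M → ℂ} (h : IsPeriod η (diff b)) :
    ∃ f : A0 M, d0 f = η :=
  ⟨⟨b, fun _ => h.isPrimitiveOn_univ.contMDiffAt univ_mem⟩,
    A1.ext fun x v => DFunLike.congr_fun (h.isPrimitiveOn_univ x (Set.mem_univ x)).mfderiv v⟩

end Periods

/-! ### The de Rham isomorphism -/

section PartitionOfUnity

variable {ι E M V : Type*} [NormedAddCommGroup E] [NormedSpace ℝ E] [TopologicalSpace M]
  [ChartedSpace E M] [NormedAddCommGroup V] [NormedSpace ℝ V]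

lemma LocalPrimitives.contMDiffAt_sub_finsum [FiniteDimensional ℝ E] [IsManifold 𝓘(ℝ, E) ∞ M]
    (P : LocalPrimitives ι M V)
    {ρ : SmoothPartitionOfUnity ι 𝓘(ℝ, E) M Set.univ} (hρ : ρ.IsSubordinate P.baseSet) {i : ι}
    {x : M} (hx : x ∈ P.baseSet i) :
    ContMDiffAt 𝓘(ℝ, E) 𝓘(ℝ, V) ∞
      (fun y => P.primitive i y - ∑ᶠ j, ρ j y • P.primitive j y) x := by
  have hsmooth : ContMDiffAt 𝓘(ℝ, E) 𝓘(ℝ, V) ∞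
      (fun y => ∑ᶠ j, ρ j y • (P.primitive i y - P.primitive j y)) x := by
    refine ρ.contMDiffAt_finsum fun j hj => ?_
    exact contMDiffAt_const.congr_of_eventuallyEq
      (P.sameIncrementsAt i j x hx (hρ j hj)).sub_eventuallyEq
  refine hsmooth.congr_of_eventuallyEq (Eventually.of_forall fun y => ?_)
  have hfinite : ∀ f : ι → V, (Function.support fun j => ρ j y • f j).Finite := fun f =>
    (ρ.locallyFinite.point_finite y).subset fun j hj h0 => hj (by
      simp only [h0, zero_smul])
  have hconst : ∑ᶠ j, ρ j y • P.primitive i y = P.primitive i y := by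
    rw [← finsum_smul, ρ.sum_eq_one (Set.mem_univ y), one_smul]
  simp only [smul_sub]
  rw [finsum_sub_distrib (hfinite _) (hfinite _), hconst]

end PartitionOfUnity

section DeRham

local notation "ℝ²" => EuclideanSpace ℝ (Fin 2)

variable {ι M : Type*} [TopologicalSpace M] [ChartedSpace ℝ² M] [IsManifold (𝓡 2) ∞ M]

lemma LocalPrimitives.exists_isPrimitiveOn_sub (P : LocalPrimitives ι M ℂ) {u : M → ℂ}
    (hu : ∀ i, ∀ x ∈ P.baseSet i,
      ContMDiffAt (𝓡 2) 𝓘(ℝ, ℂ) ∞ (fun y => P.primitive i y - u y) x) :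
    ∃ θ : Z1 M, ∀ i,
      IsPrimitiveOn θ.1.field (fun y => P.primitive i y - u y) (P.baseSet i) := by
  let η : CovectorField M := fun x =>
    mfderiv (𝓡 2) 𝓘(ℝ, ℂ) (fun y => P.primitive (P.indexAt x) y - u y) x
  have hη : ∀ i, IsPrimitiveOn η (fun y => P.primitive i y - u y) (P.baseSet i) := fun i x hx => by
    have hx' := P.mem_baseSet_at x
    refine SameIncrementsAt.hasMFDerivAt ?_ ((hu _ x hx').mdifferentiableAt (by simp)).hasMFDerivAt
    filter_upwards [P.sameIncrementsAt i (P.indexAt x) x hx hx'] with y hy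
    linear_combination hy
  obtain ⟨θ, hθ⟩ := HasSmoothPrimitives.exists_closed (η := η) fun x =>
    ⟨_, (P.isOpen_baseSet _).mem_nhds (P.mem_baseSet_at x), _, hη _,
      fun y hy => (hu _ y hy).contMDiffWithinAt⟩
  exact ⟨θ, fun i => hθ ▸ hη i⟩

lemma exists_isPeriod_cohomologous [T2Space M] [SigmaCompactSpace M] (c : Cocycle1 M ℂ) :
    ∃ (η : Z1 M) (u : M → ℂ), IsPeriod η.1 (c - diff u) := by
  have := ChartedSpace.locallyPathConnectedSpace ℝ² M
  choose U hU hx F hF using exists_isPotentialOn_nhds ℝ² c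
  let P : LocalPrimitives M M ℂ :=
    { baseSet := U
      isOpen_baseSet := hU
      indexAt := id
      mem_baseSet_at := hx
      primitive := F
      sameIncrementsAt := fun i j _ hi hj =>
        ((hF i).mono Set.inter_subset_left).sameIncrementsAt ((hF j).mono Set.inter_subset_right)
          (((hU i).inter (hU j)).mem_nhds ⟨hi, hj⟩) }
  obtain ⟨ρ, hρ⟩ := SmoothPartitionOfUnity.exists_isSubordinate (𝓡 2) isClosed_univ U hU
    fun x _ => Set.mem_iUnion.2 ⟨x, hx x⟩
  obtain ⟨η, hη⟩ := P.exists_isPrimitiveOn_sub fun i _ => P.contMDiffAt_sub_finsum hρ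
  exact ⟨η, _, fun x => ⟨U x, hU x, hx x, _, hη x, (hF x).sub (isPotentialOn_diff _ _)⟩⟩

/-- The singular class of the periods of a closed form. -/
def periodClass : Z1 M →+ H1 M ℂ :=
  AddMonoidHom.mk' (fun η => QuotientAddGroup.mk (exists_isPeriod η).choose) fun η θ =>
    congrArg QuotientAddGroup.mk ((exists_isPeriod (η + θ)).choose_spec.unique
      ((exists_isPeriod η).choose_spec.add (exists_isPeriod θ).choose_spec))

lemma IsPeriod.periodClass_eq {η : Z1 M} {c : Cocycle1 M ℂ} (h : IsPeriod η.1 c) :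
    periodClass η = QuotientAddGroup.mk c :=
  congrArg QuotientAddGroup.mk ((exists_isPeriod η).choose_spec.unique h)

lemma periodClass_eq_iff (η : Z1 M) (κ : H1 M ℂ) : periodClass η = κ ↔ Represents η κ :=
  ((exists_isPeriod η).choose_spec.represents_iff κ).symm

lemma periodClass_eq_zero_iff (η : Z1 M) : periodClass η = 0 ↔ η.1 ∈ B1 M := by
  obtain ⟨c, hc⟩ := exists_isPeriod η
  rw [hc.periodClass_eq, mk_eq_zero_iff]
  constructor
  · rintro ⟨b, rfl⟩
    exact hc.exists_d0_eq
  · rintro ⟨f, hf⟩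
    exact ⟨f, hc.unique (hf ▸ isPeriod_d0 f)⟩

lemma periodClass_surjective [T2Space M] [SigmaCompactSpace M] :
    Function.Surjective (periodClass (M := M)) := fun κ => by
  obtain ⟨c, rfl⟩ := QuotientAddGroup.mk_surjective κ
  obtain ⟨η, u, h⟩ := exists_isPeriod_cohomologous c
  have hu : (QuotientAddGroup.mk (diff u) : H1 M ℂ) = 0 := (mk_eq_zero_iff _).2 ⟨u, rfl⟩
  exact ⟨η, by rw [h.periodClass_eq, QuotientAddGroup.mk_sub, hu, sub_zero]⟩

variable (M) in
/-- The homomorphism from de Rham to singular cohomology given by periods. -/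
def deRhamHom : H1dR M →+ H1 M ℂ :=
  QuotientAddGroup.lift ((B1 M).comap (Z1 M).subtype).toAddSubgroup periodClass
    fun η hη => (periodClass_eq_zero_iff η).2 hη

lemma deRhamHom_injective : Function.Injective (deRhamHom M) := by
  rw [injective_iff_map_eq_zero]
  intro q hq
  obtain ⟨η, rfl⟩ := Submodule.Quotient.mk_surjective _ q
  exact (Submodule.Quotient.mk_eq_zero _).2 ((periodClass_eq_zero_iff η).1 hq)

variable [T2Space M] [SigmaCompactSpace M]

lemma deRhamHom_surjective : Function.Surjective (deRhamHom M) := fun κ =>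
  let ⟨η, hη⟩ := periodClass_surjective κ
  ⟨Submodule.Quotient.mk η, hη⟩

variable (M) in
/-- The de Rham isomorphism in degree one. -/
def deRhamEquiv : H1dR M ≃+ H1 M ℂ :=
  AddEquiv.ofBijective (deRhamHom M) ⟨deRhamHom_injective, deRhamHom_surjective⟩

end DeRham

/-! ### Logarithmic derivatives -/

section Exponential

/-- The homomorphism `z ↦ exp (2πiz)` onto the multiplicative group of `ℂ`, written additively so
that it can serve as a change of coefficients. -/
def expTwoPiI : ℂ →+ Additive ℂˣ :=
  AddMonoidHom.mk' (fun z => Additive.ofMul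
    (Units.mk0 (Complex.exp (2 * Real.pi * Complex.I * z)) (Complex.exp_ne_zero _))) fun z w =>
      congrArg Additive.ofMul (Units.ext (by
        rw [mul_add]
        exact Complex.exp_add _ _))

lemma coe_toMul_expTwoPiI (z : ℂ) :
    ((expTwoPiI z).toMul : ℂ) = Complex.exp (2 * Real.pi * Complex.I * z) := rfl

lemma expTwoPiI_surjective : Function.Surjective expTwoPiI := fun u => by
  refine ⟨Complex.log u.toMul / (2 * Real.pi * Complex.I), Additive.toMul.injective (Units.ext ?_)⟩
  rw [coe_toMul_expTwoPiI, mul_div_cancel₀ _ Complex.two_pi_I_ne_zero,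
    Complex.exp_log (Units.ne_zero _)]

lemma exact_intCast_expTwoPiI : Function.Exact (Int.castAddHom ℂ) expTwoPiI := fun z => by
  have hone : expTwoPiI z = 0 ↔ Complex.exp (2 * Real.pi * Complex.I * z) = 1 :=
    Additive.toMul.injective.eq_iff.symm.trans Units.ext_iff
  rw [hone, Complex.exp_eq_one_iff, Set.mem_range]
  refine exists_congr fun n => ?_
  rw [mul_comm, mul_left_inj' Complex.two_pi_I_ne_zero, eq_comm]
  rfl

lemma sameIncrementsAt_ofMul_comp_iff {X : Type*} [TopologicalSpace X] {f : X → ℂˣ} {F : X → ℂ}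
    {x : X} : SameIncrementsAt (expTwoPiI ∘ F) (Additive.ofMul ∘ f) x ↔
      ∀ᶠ y in 𝓝 x, (f y : ℂ) = f x * Complex.exp (2 * Real.pi * Complex.I * (F y - F x)) := by
  refine eventually_congr (Eventually.of_forall fun y => ?_)
  rw [← coe_toMul_expTwoPiI, ← Units.val_mul, Units.val_inj, map_sub, eq_comm]
  exact div_eq_iff_eq_mul' (G := ℂˣ)

end Exponential

section LogDerivative

variable {E M : Type*} [NormedAddCommGroup E] [NormedSpace ℝ E] [TopologicalSpace M]
  [ChartedSpace E M]

lemma hasMFDerivAt_comp_of_hasDerivAt {φ : ℂ → ℂ} {φ' : ℂ} {F : M → ℂ} {x : M}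
    {D : TangentSpace 𝓘(ℝ, E) x →L[ℝ] ℂ} (hφ : HasDerivAt φ φ' (F x))
    (hF : HasMFDerivAt 𝓘(ℝ, E) 𝓘(ℝ, ℂ) F x D) :
    HasMFDerivAt 𝓘(ℝ, E) 𝓘(ℝ, ℂ) (φ ∘ F) x (φ' • D) := by
  refine ((hφ.hasFDerivAt.restrictScalars ℝ).hasMFDerivAt.comp x hF).congr_mfderiv ?_
  ext v
  exact mul_comm (D v) φ'

end LogDerivative

section LogPrimitives

variable {M : Type*} [TopologicalSpace M] [ChartedSpace (EuclideanSpace ℝ (Fin 2)) M]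

/-- The nowhere vanishing function `f` satisfies `df = 2πi f θ`, so that `θ` is `(2πi)⁻¹` times its
logarithmic derivative. -/
def IsLogPrimitive (θ : CovectorField M) (f : M → ℂˣ) : Prop :=
  ∀ x, HasMFDerivAt (𝓡 2) 𝓘(ℝ, ℂ) (fun y => (f y : ℂ)) x
    ((f x * (2 * Real.pi * Complex.I) : ℂ) • θ x)

lemma isLogPrimitive_of_sameIncrementsAt {θ : CovectorField M} {f : M → ℂˣ}
    (h : ∀ x, ∃ U ∈ 𝓝 x, ∃ F, IsPrimitiveOn θ F U ∧
      SameIncrementsAt (expTwoPiI ∘ F) (Additive.ofMul ∘ f) x) : IsLogPrimitive θ f := fun x => by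
  obtain ⟨U, hU, F, hF, hFf⟩ := h x
  have hexp : HasDerivAt (fun w => (f x : ℂ) * Complex.exp (2 * Real.pi * Complex.I * (w - F x)))
      (f x * (2 * Real.pi * Complex.I)) (F x) := by
    simpa using
      ((((hasDerivAt_id (F x)).sub_const (F x)).const_mul (2 * Real.pi * Complex.I)).cexp).const_mul
        (f x : ℂ)
  exact (hasMFDerivAt_comp_of_hasDerivAt hexp (hF x (mem_of_mem_nhds hU))).congr_of_eventuallyEq
    (sameIncrementsAt_ofMul_comp_iff.1 hFf)

variable [IsManifold (𝓡 2) ∞ M]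

lemma IsLogPrimitive.sameIncrementsAt {θ : CovectorField M} {f : M → ℂˣ} {F : M → ℂ} {U : Set M}
    {x : M} (hf : IsLogPrimitive θ f) (hF : IsPrimitiveOn θ F U) (hU : U ∈ 𝓝 x) :
    SameIncrementsAt (expTwoPiI ∘ F) (Additive.ofMul ∘ f) x := by
  set a : ℂ := 2 * Real.pi * Complex.I with ha
  have hzero : ∀ᶠ y in 𝓝 x, HasMFDerivAt (𝓡 2) 𝓘(ℝ, ℂ)
      (fun z => f z * Complex.exp (-a * F z)) y 0 := by
    filter_upwards [hU] with y hy
    have hexp : HasDerivAt (fun w => Complex.exp (-a * w)) (Complex.exp (-a * F y) * -a) (F y) := by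
      simpa using ((hasDerivAt_id (F y)).const_mul (-a)).cexp
    refine ((hf y).mul (hasMFDerivAt_comp_of_hasDerivAt hexp (hF y hy))).congr_mfderiv ?_
    ext v
    change f y * (Complex.exp (-a * F y) * -a * θ y v)
      + Complex.exp (-a * F y) * (f y * a * θ y v) = 0
    ring
  rw [sameIncrementsAt_ofMul_comp_iff]
  filter_upwards [eventually_eq_of_hasMFDerivAt_zero hzero] with y hy
  have hexp : Complex.exp (a * (F y - F x))
      = Complex.exp (-a * F x) * (Complex.exp (-a * F y))⁻¹ := by
    rw [← Complex.exp_neg, ← Complex.exp_add]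
    ring_nf
  rw [← ha, hexp, ← mul_assoc, ← hy, mul_inv_cancel_right₀ (Complex.exp_ne_zero _)]

lemma IsLogPrimitive.contMDiff {θ : Z1 M} {f : M → ℂˣ} (hf : IsLogPrimitive θ.1.field f) :
    ContMDiff (𝓡 2) 𝓘(ℝ, ℂ) ∞ f := by
  refine ContMDiff.of_comp_isOpenEmbedding Units.isOpenEmbedding_val fun x => ?_
  obtain ⟨U, hU, hxU, F, hF⟩ := exists_isPrimitiveOn θ x
  have hUx := hU.mem_nhds hxU
  have hexp : ContDiff ℝ ∞ fun w : ℂ =>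
      (f x : ℂ) * Complex.exp (2 * Real.pi * Complex.I * (w - F x)) := by fun_prop
  exact (hexp.contMDiff.contMDiffAt.comp x (hF.contMDiffAt hUx)).congr_of_eventuallyEq
    (sameIncrementsAt_ofMul_comp_iff.1 (hf.sameIncrementsAt hF hUx))

lemma IsPeriod.isLogPrimitive_iff {θ : A1 M} {c : Cocycle1 M ℂ} (hc : IsPeriod θ c) (f : M → ℂˣ) :
    IsLogPrimitive θ.field f ↔ cocycleMap M expTwoPiI c = diff (Additive.ofMul ∘ f) := by
  have hmap : ∀ {F : M → ℂ} {U : Set M}, IsPotentialOn c F U →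
      IsPotentialOn (cocycleMap M expTwoPiI c) (expTwoPiI ∘ F) U := fun hcF σ hσ =>
    (congrArg expTwoPiI (hcF σ hσ)).trans (map_sub _ _ _)
  constructor
  · refine fun hf => cocycle_eq_of_sameIncrementsAt fun x => ?_
    obtain ⟨U, hU, hxU, F, hF, hcF⟩ := hc x
    have hUx := hU.mem_nhds hxU
    exact ⟨U, hUx, _, _, hmap hcF, isPotentialOn_diff _ _, hf.sameIncrementsAt hF hUx⟩
  · refine fun h => isLogPrimitive_of_sameIncrementsAt fun x => ?_
    obtain ⟨U, hU, hxU, F, hF, hcF⟩ := hc x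
    have hUx := hU.mem_nhds hxU
    have := ChartedSpace.locallyPathConnectedSpace (EuclideanSpace ℝ (Fin 2)) M
    exact ⟨U, hUx, F, hF, (hmap hcF).sameIncrementsAt (h ▸ isPotentialOn_diff _ _) hUx⟩

lemma exists_isLogPrimitive_iff (θ : Z1 M) : (∃ f, IsLogPrimitive θ.1.field f) ↔
    periodClass θ ∈ (coeffMap M (Int.castAddHom ℂ)).range := by
  obtain ⟨c, hc⟩ := exists_isPeriod θ
  have hexact := coeffMap_exact (X := M) Int.cast_injective exact_intCast_expTwoPiI
    expTwoPiI_surjective (periodClass θ)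
  rw [AddMonoidHom.mem_range, ← Set.mem_range, ← hexact, hc.periodClass_eq, coeffMap_mk,
    mk_eq_zero_iff]
  exact exists_congr hc.isLogPrimitive_iff

end LogPrimitives

/-! ### Flat connections -/

section GaugeTransformations

variable {M : Type*} [TopologicalSpace M] [ChartedSpace (EuclideanSpace ℝ (Fin 2)) M]
  [IsManifold (𝓡 2) ∞ M]

/-- The logarithmic derivative `g⁻¹dg` of a gauge transformation. -/
def Gauge.logDeriv (g : Gauge M) : A1 M := Gauge.toA0 g⁻¹ • d0 g.toA0

lemma Gauge.logDeriv_eq_iff {g : Gauge M} {η : A1 M} : g.logDeriv = η ↔ d0 g.toA0 = g.toA0 • η := by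
  constructor
  · rintro rfl
    rw [Gauge.logDeriv, ← mul_smul_form, mul_comm, Gauge.toA0_inv_mul, one_smul_form]
  · intro h
    rw [Gauge.logDeriv, h, ← mul_smul_form, Gauge.toA0_inv_mul, one_smul_form]

lemma isLogPrimitive_iff_logDeriv_eq (θ : A1 M) (g : Gauge M) :
    IsLogPrimitive θ.field g ↔ g.logDeriv = (2 * Real.pi * Complex.I : ℂ) • θ := by
  have hsmul : ∀ x, (g.toA0 • (2 * Real.pi * Complex.I : ℂ) • θ).field x
      = (g x * (2 * Real.pi * Complex.I) : ℂ) • θ.field x := fun x => smul_smul _ _ _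
  rw [Gauge.logDeriv_eq_iff]
  constructor
  · exact fun h => A1.ext fun x => DFunLike.congr_fun ((h x).mfderiv.trans (hsmul x).symm)
  · intro h x
    rw [← hsmul, ← h]
    exact isPrimitiveOn_d0 g.toA0 Set.univ x (Set.mem_univ x)

lemma exists_logDeriv_eq_iff (θ : Z1 M) :
    (∃ g : Gauge M, g.logDeriv = (2 * Real.pi * Complex.I : ℂ) • θ.1) ↔
      periodClass θ ∈ (coeffMap M (Int.castAddHom ℂ)).range := by
  rw [← exists_isLogPrimitive_iff]
  constructor
  · rintro ⟨g, hg⟩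
    exact ⟨g, (isLogPrimitive_iff_logDeriv_eq θ.1 g).2 hg⟩
  · rintro ⟨f, hf⟩
    exact ⟨⟨f, hf.contMDiff⟩, (isLogPrimitive_iff_logDeriv_eq θ.1 ⟨f, hf.contMDiff⟩).1 hf⟩

end GaugeTransformations

section ConnectionForms

variable {M : Type*} [TopologicalSpace M] [ChartedSpace (EuclideanSpace ℝ (Fin 2)) M]
  [IsManifold (𝓡 2) ∞ M]

lemma inChart_chartDeriv (η : CovectorField M) (x : M) (v : TangentSpace (𝓡 2) x) :
    η.inChart x (extChartAt (𝓡 2) x x) (chartDeriv x v) = η x v :=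
  DFunLike.congr_fun (inChart_comp_mfderiv_chart η (mem_extChartAt_source x)) v

lemma d1_smul_form (s : A0 M) (η : A1 M) (x : M) :
    d1 (s • η) x = s x • d1 η x + wedge ((d0 s).field x) (η.field x) := by
  ext v
  set y := extChartAt (𝓡 2) x x
  set w := η.field.inChart x
  have hw := differentiableAt_inChart η x
  have hs := hasFDerivAt_comp_chart_symm (mem_extChartAt_target x)
    (isPrimitiveOn_d0 s _ _ (Set.mem_univ _))
  have hsx : (s ∘ (extChartAt (𝓡 2) x).symm) y = s x := congrArg s (extChartAt_to_inv x)
  have hderiv : fderiv ℝ ((s • η).field.inChart x) y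
      = s x • fderiv ℝ w y + ((d0 s).field.inChart x y).smulRight (w y) := by
    rw [show (s • η).field.inChart x = (s ∘ (extChartAt (𝓡 2) x).symm) • w from inChart_mul _ _ _,
      (hs.smul hw.hasFDerivAt).fderiv, hsx]
  rw [ContinuousAlternatingMap.add_apply, ContinuousAlternatingMap.smul_apply, d1_apply, d1_apply,
    planeDeriv_apply (differentiableAt_inChart _ x), planeDeriv_apply hw, hderiv]
  change (s x * fderiv ℝ w y (chartDeriv x (v 0)) (chartDeriv x (v 1))
      + (d0 s).field.inChart x y (chartDeriv x (v 0)) * w y (chartDeriv x (v 1)))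
    - (s x * fderiv ℝ w y (chartDeriv x (v 1)) (chartDeriv x (v 0))
      + (d0 s).field.inChart x y (chartDeriv x (v 1)) * w y (chartDeriv x (v 0)))
    = s x * (fderiv ℝ w y (chartDeriv x (v 0)) (chartDeriv x (v 1))
        - fderiv ℝ w y (chartDeriv x (v 1)) (chartDeriv x (v 0)))
      + ((d0 s).field x (v 0) * η.field x (v 1) - (d0 s).field x (v 1) * η.field x (v 0))
  rw [inChart_chartDeriv, inChart_chartDeriv, inChart_chartDeriv, inChart_chartDeriv]
  ring

lemma Connection.toHom_eq (D : Connection M) (s : A0 M) : D.toHom s = s • D.toHom 1 + d0 s := by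
  have h := D.leibniz s 1
  rwa [mul_one, one_smul_form] at h

lemma Connection.ext_toHom_one {D D' : Connection M} (h : D.toHom 1 = D'.toHom 1) : D = D' :=
  Connection.ext (AddMonoidHom.ext fun s => by rw [D.toHom_eq, D'.toHom_eq, h])

/-- The connection `s ↦ s η + ds` with connection form `η`. -/
def Connection.ofForm (η : A1 M) : Connection M where
  toHom := AddMonoidHom.mk' (fun s => s • η + d0 s) fun s t => by
    have hadd : (s + t) • η = s • η + t • η := A1.ext fun _ _ => add_mul _ _ _
    rw [hadd, map_add, add_add_add_comm]
  leibniz f s := by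
    change (f * s) • η + d0 (f * s) = f • (s • η + d0 s) + s • d0 f
    rw [d0_mul, mul_smul_form, smul_add_form, add_assoc]

lemma Connection.ofForm_toHom_one (η : A1 M) : (Connection.ofForm η).toHom 1 = η := by
  have hone : d0 (1 : A0 M) = 0 := d0_const 1
  change (1 : A0 M) • η + d0 1 = η
  rw [hone, one_smul_form, add_zero]

lemma Connection.extend_toHom (D : Connection M) (s : A0 M) (x : M) :
    D.extend (D.toHom s) x = s x • d1 (D.toHom 1) x := by
  have hwedge : wedge ((s • D.toHom 1 + d0 s).field x) ((D.toHom 1).field x)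
      = wedge ((d0 s).field x) ((D.toHom 1).field x) := by
    ext v
    change (s x * (D.toHom 1).field x (v 0) + (d0 s).field x (v 0)) * (D.toHom 1).field x (v 1)
        - (s x * (D.toHom 1).field x (v 1) + (d0 s).field x (v 1)) * (D.toHom 1).field x (v 0)
      = (d0 s).field x (v 0) * (D.toHom 1).field x (v 1)
        - (d0 s).field x (v 1) * (D.toHom 1).field x (v 0)
    ring
  rw [Connection.extend, D.toHom_eq s, hwedge, d1_add, d1_d0, d1_smul_form, add_zero,
    add_sub_cancel_right]

lemma Connection.isFlat_iff (D : Connection M) : D.IsFlat ↔ D.toHom 1 ∈ Z1 M := by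
  constructor
  · intro h x
    rw [← one_smul ℂ (d1 (D.toHom 1) x)]
    exact (D.extend_toHom 1 x).symm.trans (h 1 x)
  · intro h s x
    rw [D.extend_toHom, h x]
    ext
    exact mul_zero (s x)

lemma gauge_smul_toHom_one (g : Gauge M) (D : Connection M) :
    (g • D).toHom 1 = D.toHom 1 + g.logDeriv := by
  change Gauge.toA0 g⁻¹ • D.toHom (g.toA0 * 1) = _
  rw [mul_one, D.toHom_eq, smul_add_form, ← mul_smul_form, Gauge.toA0_inv_mul, one_smul_form,
    Gauge.logDeriv]

lemma orbitRel_iff_exists_logDeriv {D D' : Connection M} :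
    MulAction.orbitRel (Gauge M) (Connection M) D D' ↔
      ∃ g : Gauge M, g.logDeriv = D.toHom 1 - D'.toHom 1 := by
  rw [MulAction.orbitRel_apply, MulAction.mem_orbit_iff]
  refine exists_congr fun g => ?_
  rw [eq_sub_iff_add_eq', ← gauge_smul_toHom_one]
  exact ⟨congrArg fun D : Connection M => D.toHom 1, Connection.ext_toHom_one⟩

/-- The closed connection form of a flat connection. -/
def connectionForm (D : FlatConnection M) : Z1 M := ⟨D.1.toHom 1, D.1.isFlat_iff.1 D.2⟩

lemma connectionForm_surjective : Function.Surjective (connectionForm (M := M)) := fun η =>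
  ⟨⟨Connection.ofForm η.1, (Connection.isFlat_iff _).2
    ((Connection.ofForm_toHom_one η.1).symm ▸ η.2)⟩,
    Subtype.ext (Connection.ofForm_toHom_one η.1)⟩

end ConnectionForms

/-! ### The moduli space -/

section ModuliSpace

variable (M : Type*) [TopologicalSpace M] [T2Space M] [SigmaCompactSpace M]
  [ChartedSpace (EuclideanSpace ℝ (Fin 2)) M] [IsManifold (𝓡 2) ∞ M]

/-- The map `i^*` from integral to de Rham cohomology. -/
def intToDeRham : H1 M ℤ →+ H1dR M :=
  (deRhamEquiv M).symm.toAddMonoidHom.comp (coeffMap M (Int.castAddHom ℂ))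

lemma intToDeRham_injective : Function.Injective (intToDeRham M) :=
  (deRhamEquiv M).symm.injective.comp (coeffMap_injective Int.cast_injective)

variable {M}

lemma mk_mem_range_intToDeRham_iff (θ : Z1 M) :
    (Submodule.Quotient.mk θ : H1dR M) ∈ (intToDeRham M).range ↔
      periodClass θ ∈ (coeffMap M (Int.castAddHom ℂ)).range :=
  exists_congr fun _ => (deRhamEquiv M).symm_apply_eq

/-- The class of `(2πi)⁻¹` times the connection form of a flat connection. -/
def flatClass (D : FlatConnection M) : H1dR M ⧸ (intToDeRham M).range :=
  QuotientAddGroup.mk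
    ((2 * Real.pi * Complex.I : ℂ)⁻¹ • (Submodule.Quotient.mk (connectionForm D) : H1dR M))

lemma flatClass_eq_iff {D D' : FlatConnection M} : flatClass D = flatClass D' ↔
    MulAction.orbitRel (Gauge M) (Connection M) D.1 D'.1 := by
  have hform : (2 * Real.pi * Complex.I : ℂ) •
      ((2 * Real.pi * Complex.I : ℂ)⁻¹ • (connectionForm D - connectionForm D')).1
        = D.1.toHom 1 - D'.1.toHom 1 := smul_inv_smul₀ Complex.two_pi_I_ne_zero _
  rw [orbitRel_iff_exists_logDeriv, ← hform, exists_logDeriv_eq_iff,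
    ← mk_mem_range_intToDeRham_iff, ← sub_eq_zero, flatClass, flatClass, ← QuotientAddGroup.mk_sub,
    QuotientAddGroup.eq_zero_iff, ← smul_sub, ← Submodule.Quotient.mk_sub,
    ← Submodule.Quotient.mk_smul]

lemma flatClass_surjective : Function.Surjective (flatClass (M := M)) := fun q => by
  obtain ⟨q, rfl⟩ := QuotientAddGroup.mk_surjective q
  obtain ⟨θ, rfl⟩ := Submodule.Quotient.mk_surjective _ q
  obtain ⟨D, hD⟩ := connectionForm_surjective ((2 * Real.pi * Complex.I : ℂ) • θ)
  exact ⟨D, by rw [flatClass, hD, Submodule.Quotient.mk_smul,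
    inv_smul_smul₀ Complex.two_pi_I_ne_zero]⟩

variable (M) in
/-- The bijection from the de Rham moduli space to the cokernel of `i^*`. -/
def moduliEquiv : Moduli M ≃ H1dR M ⧸ (intToDeRham M).range :=
  Equiv.ofBijective (Quotient.lift flatClass fun _ _ => flatClass_eq_iff.2)
    ⟨Quotient.ind₂ fun _ _ h => Quotient.sound (flatClass_eq_iff.1 h),
      Quotient.lift_surjective _ _ flatClass_surjective⟩

end ModuliSpace

end FlatLine
end

theorem mainTheorem6_general {S : Type*} [TopologicalSpace S] [SigmaCompactSpace S] [T2Space S]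
    [ChartedSpace (EuclideanSpace ℝ (Fin 2)) S] [IsManifold (𝓡 2) ∞ S] :
    ∃ dR : FlatLine.H1dR S ≃+ FlatLine.H1 S ℂ,
      (∀ (η : FlatLine.Z1 S) (κ : FlatLine.H1 S ℂ),
        dR (Submodule.Quotient.mk η) = κ ↔ FlatLine.Represents η κ) ∧
      ∃ i : FlatLine.H1 S ℤ →+ FlatLine.H1dR S,
        i = dR.symm.toAddMonoidHom.comp (FlatLine.coeffMap S (Int.castAddHom ℂ)) ∧
        Function.Injective i ∧
        ∃ Φ : FlatLine.Moduli S ≃ FlatLine.H1dR S ⧸ i.range,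
          ∀ D : FlatLine.FlatConnection S, ∃ η : FlatLine.Z1 S,
            (η : FlatLine.A1 S) = D.1.toHom 1 ∧
            Φ (Quotient.mk _ D) = QuotientAddGroup.mk
              ((2 * Real.pi * Complex.I)⁻¹ • (Submodule.Quotient.mk η : FlatLine.H1dR S)) :=
  ⟨FlatLine.deRhamEquiv S, FlatLine.periodClass_eq_iff, FlatLine.intToDeRham S, rfl,
    FlatLine.intToDeRham_injective S, FlatLine.moduliEquiv S,
    fun D => ⟨FlatLine.connectionForm D, rfl, rfl⟩⟩

theorem mainTheorem6 {S : Type*} [TopologicalSpace S] [CompactSpace S] [T2Space S]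
    [ChartedSpace (EuclideanSpace ℝ (Fin 2)) S] [IsManifold (𝓡 2) ∞ S] :
    -- the de Rham isomorphism, given by integration
    ∃ dR : FlatLine.H1dR S ≃+ FlatLine.H1 S ℂ,
      (∀ (η : FlatLine.Z1 S) (κ : FlatLine.H1 S ℂ),
        dR (Submodule.Quotient.mk η) = κ ↔ FlatLine.Represents η κ) ∧
      -- the map induced by the inclusion of the integers in the complex numbers
      ∃ i : FlatLine.H1 S ℤ →+ FlatLine.H1dR S,
        i = dR.symm.toAddMonoidHom.comp (FlatLine.coeffMap S (Int.castAddHom ℂ)) ∧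
        Function.Injective i ∧
        -- the identification of the moduli space with the cokernel
        ∃ Φ : FlatLine.Moduli S ≃ FlatLine.H1dR S ⧸ i.range,
          ∀ D : FlatLine.FlatConnection S, ∃ η : FlatLine.Z1 S,
            (η : FlatLine.A1 S) = D.1.toHom 1 ∧
            Φ (Quotient.mk _ D) = QuotientAddGroup.mk
              ((2 * Real.pi * Complex.I)⁻¹ • (Submodule.Quotient.mk η : FlatLine.H1dR S)) :=
  mainTheorem6_general
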